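/- Let $\mathscr R$ be a nontrivial totally ordered abelian group, written multiplicatively, that is divisible, archimedean and conditionally complete (so $\mathscr R\cong(\mathbb R_{>0},\cdot)$), regarded as a bipotent semifield with addition $a\dotplus b=\max(a,b)$, and let $n\ge 0$. Polynomials (finite nonempty sums of monomials $c\,x_1^{k_1}\cdots x_n^{k_n}$ with $c\in\mathscr R$, $k_i\in\mathbb N$) and fractions of polynomials are regarded as functions $\mathscr R^n\to\mathscr R$; let $\mathscr R(x_1,\dots,x_n)$ be the semifield of these fractions, with pointwise operations. A kernel of a semifield $\mathbb S$ is a subgroup $K$ of its multiplicative group such that $xa\dotplus yb\in K$ whenever $a,b\in K$, $x,y\in\mathbb S$ and $x\dotplus y=1$. It is principal if it is the smallest kernel $\langle f\rangle$ containing some element $f\in\mathbb S$. Let $\langle\mathscr R\rangle$ be the smallest kernel of $\mathscr R(x_1,\dots,x_n)$ that contains the constants; it is itself a semifield. An element $f$ of $\mathscr R(x_1,\dots,x_n)$ is regular if $f=\frac{h}{g}$ with $h=\sum_i h_i$, $g=\sum_j g_j$ finite sums of monomials such that for every $x\in\mathscr R^n$ there are $i,j$ with $h(x)=h_i(x)$,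 $g(x)=g_j(x)$ and $h_i\ne g_j$. A principal kernel of $\langle\mathscr R\rangle$ is regular if it is generated by a regular element of $\langle\mathscr R\rangle$. For a kernel $K$ put $Skel(K)=\{a\in\mathscr R^n: f(a)=1\ \forall f\in K\}$, and for $Z\subseteq\mathscr R^n$ put $Ker(Z)=\{f\in\langle\mathscr R\rangle: f(a)=1\ \forall a\in Z\}$. Let $R=\mathscr R\cup\nu(\mathscr R)$ be the supertropical semiring, where $\nu(\mathscr R)$ is a copy of $\mathscr R$ whose elements are called ghosts, the elements of $\mathscr R$ being called tangible: $a$ and $\nu(a)$ both have value $a$; the sum of two elements of different values is the one of larger value, and the sum of two elements of equal value $a$ is $\nu(a)$; values multiply, and a product is a ghost as soon as one of the factors is. A point $a\in\mathscr R^n$ is a corner root of a supertropical polynomial $f$ (a nonzero polynomial in $x_1,\dots,x_n$ with coefficients in $R$) if $f(a)$ is a ghost; $f$ is tangible if all its coefficients are tangible. A finitely generated corner locus (supertropical variety) is the set $Cor(f_1,\dots,f_r)$ of common corner roots of finitely many supertropical polynomials $f_1,\dots,f_r$, $r\ge1$; it is a regular finitely generated corner locus (tropical variety) if $f_1,\dots,f_r$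 can be taken tangible. Then $K\mapsto Skel(K)$ is an order-reversing bijection from the set of principal kernels of $\langle\mathscr R\rangle$ onto the set of finitely generated corner loci in $\mathscr R^n$, with inverse $Z\mapsto Ker(Z)$; the principal kernels are closed under products and intersections, the finitely generated corner loci are closed under intersections and unions, $Skel(K\cdot L)=Skel(K)\cap Skel(L)$ and $Skel(K\cap L)=Skel(K)\cup Skel(L)$; and $K\subseteq L$ if and only if $Skel(L)\subseteq Skel(K)$. This correspondence restricts to one between regular principal kernels of $\langle\mathscr R\rangle$ (again closed under products and intersections) and regular finitely generated corner loci in $\mathscr R^n$ (again closed under intersections and unions). -/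

import Mathlib

open Set

noncomputable section

namespace TropKernel

/-! ### The supertropical semiring -/

/-- The supertropical semiring `R ∪ ν(R)` over a totally ordered group `R`: `tangible a` is `a`,
`ghost a` is `ν(a)`. A zero element is adjoined, so that polynomials over it are polynomials in
the sense of Mathlib (the zero coefficient marks an absent monomial). -/
inductive Supertropical (R : Type*) where
  | zero : Supertropical R
  | tangible (a : R) : Supertropical R
  | ghost (a : R) : Supertropical R

namespace Supertropical

/-- Membership in the ghost ideal `ν(R)`. -/
def IsGhost {R : Type*} (x : Supertropical R) : Prop := ∃ a : R, x = ghost a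

/-- Membership in the set `R` of tangible elements. -/
def IsTangible {R : Type*} (x : Supertropical R) : Prop := ∃ a : R, x = tangible a

/-- The summand with the larger value wins; summands of equal value add up to a ghost. -/
def add {R : Type*} [LinearOrder R] : Supertropical R → Supertropical R → Supertropical R
  | zero, y => y
  | x, zero => x
  | tangible a, tangible b => if a < b then tangible b else if b < a then tangible a else ghost a
  | tangible a, ghost b => if b < a then tangible a else ghost b
  | ghost a, tangible b => if a < b then tangible b else ghost a
  | ghost a, ghost b => ghost (max a b)

/-- Values are multiplied; a product is tangible only if both factors are. -/
def mul {R : Type*} [CommGroup R] : Supertropical R → Supertropical R → Supertropical R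
  | zero, _ => zero
  | _, zero => zero
  | tangible a, tangible b => tangible (a * b)
  | tangible a, ghost b => ghost (a * b)
  | ghost a, tangible b => ghost (a * b)
  | ghost a, ghost b => ghost (a * b)

instance instZero {R : Type*} : Zero (Supertropical R) := ⟨zero⟩

instance instOne {R : Type*} [CommGroup R] : One (Supertropical R) := ⟨tangible 1⟩

instance instAdd {R : Type*} [LinearOrder R] : Add (Supertropical R) := ⟨add⟩

instance instMul {R : Type*} [CommGroup R] : Mul (Supertropical R) := ⟨mul⟩

theorem mul_comm' {R : Type*} [CommGroup R] (x y : Supertropical R) : mul x y = mul y x := by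
  rcases x with _ | a | a <;> rcases y with _ | b | b <;> simp [mul, mul_comm]

theorem mul_add' {R : Type*} [CommGroup R] [LinearOrder R] [IsOrderedMonoid R]
    (x y z : Supertropical R) : mul x (add y z) = add (mul x y) (mul x z) := by
  rcases x with _ | a | a <;> rcases y with _ | b | b <;> rcases z with _ | c | c <;>
    try rfl
  all_goals
    rcases lt_trichotomy b c with h | h | h
    · simp [add, mul, h, h.not_gt, h.le]
    · simp [add, mul, h]
    · simp [add, mul, h, h.not_gt, h.le]

instance instCommSemiring {R : Type*} [CommGroup R] [LinearOrder R] [IsOrderedMonoid R] :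
    CommSemiring (Supertropical R) where
  nsmul := nsmulRec
  npow := npowRec
  add_assoc := by
    have h : ∀ x y z : Supertropical R, add (add x y) z = add x (add y z) := by
      rintro (_ | a | a) (_ | b | b) (_ | c | c) <;> grind [add]
    exact h
  zero_add := by
    have h : ∀ x : Supertropical R, add zero x = x := by
      rintro (_ | a | a) <;> rfl
    exact h
  add_zero := by
    have h : ∀ x : Supertropical R, add x zero = x := by
      rintro (_ | a | a) <;> rfl
    exact h
  add_comm := by
    have h : ∀ x y : Supertropical R, add x y = add y x := by
      rintro (_ | a | a) (_ | b | b) <;> grind [add]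
    exact h
  mul_assoc := by
    have h : ∀ x y z : Supertropical R, mul (mul x y) z = mul x (mul y z) := by
      rintro (_ | a | a) (_ | b | b) (_ | c | c) <;> simp [mul, mul_assoc]
    exact h
  mul_comm := mul_comm'
  one_mul := by
    have h : ∀ x : Supertropical R, mul (tangible 1) x = x := by
      rintro (_ | a | a) <;> simp [mul]
    exact h
  mul_one := by
    have h : ∀ x : Supertropical R, mul x (tangible 1) = x := by
      rintro (_ | a | a) <;> simp [mul]
    exact h
  zero_mul := by
    have h : ∀ x : Supertropical R, mul zero x = zero := by
      rintro (_ | a | a) <;> rfl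
    exact h
  mul_zero := by
    have h : ∀ x : Supertropical R, mul x zero = zero := by
      rintro (_ | a | a) <;> rfl
    exact h
  left_distrib := mul_add'
  right_distrib := by
    have h : ∀ x y z : Supertropical R, mul (add x y) z = add (mul x z) (mul y z) := by
      intro x y z
      rw [mul_comm', mul_add', mul_comm' z x, mul_comm' z y]
    exact h

end Supertropical

/-! ### Corner loci -/

section CornerLoci

variable {R : Type*} [CommGroup R] [LinearOrder R] [IsOrderedMonoid R] {n : ℕ}

/-- The point `a` of `Rⁿ` is a corner root of the supertropical polynomial `f` if `f(a)` is a
ghost. -/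
def IsCornerRoot (f : MvPolynomial (Fin n) (Supertropical R)) (a : Fin n → R) : Prop :=
  (MvPolynomial.eval (fun i => Supertropical.tangible (a i)) f).IsGhost

/-- A supertropical polynomial is tangible if none of its component monomials is ghost. -/
def IsTangiblePoly (f : MvPolynomial (Fin n) (Supertropical R)) : Prop :=
  ∀ k ∈ f.support, (f.coeff k).IsTangible

/-- The corner locus `Cor(S)`: the set of common corner roots of the polynomials in `S`. -/
def Cor (S : Set (MvPolynomial (Fin n) (Supertropical R))) : Set (Fin n → R) :=
  {a | ∀ f ∈ S, IsCornerRoot f a}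

variable (R n) in
/-- `FCL(Rⁿ)`: the sets `Cor(f₁, …, f_r)`, `r ≥ 1`, with `f₁, …, f_r` (nonzero) supertropical
polynomials. -/
def FCL : Set (Set (Fin n → R)) :=
  {Z | ∃ S : Set (MvPolynomial (Fin n) (Supertropical R)),
    S.Finite ∧ S.Nonempty ∧ (∀ f ∈ S, f ≠ 0) ∧ Z = Cor S}

variable (R n) in
/-- `FRCL(Rⁿ)`: the sets `Cor(f₁, …, f_r)`, `r ≥ 1`, with `f₁, …, f_r` (nonzero) tangible
polynomials. -/
def FRCL : Set (Set (Fin n → R)) :=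
  {Z | ∃ S : Set (MvPolynomial (Fin n) (Supertropical R)),
    S.Finite ∧ S.Nonempty ∧ (∀ f ∈ S, f ≠ 0 ∧ IsTangiblePoly f) ∧ Z = Cor S}

end CornerLoci

/-! ### Idempotent semifields and their kernels

An idempotent (commutative, zero-free) semifield is a commutative lattice-ordered group, with `⊔`
as its addition. -/

/-- A subsemifield: a subset closed under multiplication, inverses and addition `⊔`. -/
structure Subsemifield (S : Type*) [CommGroup S] [Lattice S] extends Subgroup S where
  sup_mem' : ∀ {a b : S}, a ∈ carrier → b ∈ carrier → a ⊔ b ∈ carrier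

section Kernels

variable {S : Type*} [CommGroup S] [Lattice S]

/-- `K` is a (semifield) kernel of the semifield `U`: a (normal) subgroup of `U` such that
`x a ⊔ y b ∈ K` for all `a, b ∈ K` and all `x, y ∈ U` with `x ⊔ y = 1`. -/
def IsKernel (U : Subsemifield S) (K : Subgroup S) : Prop :=
  K ≤ U.toSubgroup ∧
    ∀ x ∈ U.toSubgroup, ∀ y ∈ U.toSubgroup, x ⊔ y = 1 →
      ∀ a ∈ K, ∀ b ∈ K, x * a ⊔ y * b ∈ K

/-- `⟨A⟩`: the smallest kernel of `U` that contains the subset `A` of `U`. -/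
def kernelSpan (U : Subsemifield S) (A : Set S) : Subgroup S :=
  sInf {K : Subgroup S | IsKernel U K ∧ A ⊆ K}

/-- The set `PCon(U)` of the principal kernels of the semifield `U`. Kernels are multiplied and
intersected as the subgroups that they are: since the group is abelian, `K ⊔ L` is the product
`{a * b | a ∈ K, b ∈ L}`. -/
def PCon (U : Subsemifield S) : Set (Subgroup S) :=
  {K | ∃ f ∈ U.toSubgroup, K = kernelSpan U {f}}

theorem kernelSpan_sup_mem (U : Subsemifield S) (A : Set S) {a b : S}
    (ha : a ∈ kernelSpan U A) (hb : b ∈ kernelSpan U A) : a ⊔ b ∈ kernelSpan U A := by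
  simp only [kernelSpan, Subgroup.mem_sInf] at ha hb ⊢
  intro K hK
  have h := hK.1.2 1 (one_mem _) 1 (one_mem _) (sup_idem 1) a (ha K hK) b (hb K hK)
  simpa using h

end Kernels

/-! ### The semifield of fractions, skeletons -/

section Fractions

variable {R : Type*} [CommGroup R] [LinearOrder R] {n : ℕ}

/-- The monomial `c x₁^{k₁} ⋯ xₙ^{kₙ}`, given by the pair `(k, c)`. -/
abbrev Monom (R : Type*) (n : ℕ) : Type _ := (Fin n → ℕ) × R

def Monom.eval (m : Monom R n) (a : Fin n → R) : R := m.2 * ∏ i, a i ^ m.1 i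

/-- A polynomial of `R[x₁, …, xₙ]`: a nonempty finite sum of distinct monomials. -/
structure TropPoly (R : Type*) (n : ℕ) where
  monoms : Finset (Monom R n)
  nonempty : monoms.Nonempty

/-- The value of a polynomial: the sum of a semifield whose addition is the maximum. -/
def TropPoly.eval (p : TropPoly R n) (a : Fin n → R) : R :=
  p.monoms.sup' p.nonempty fun m => m.eval a

/-- `f = h / g` in the semiring of functions. -/
def IsFraction (f : (Fin n → R) → R) (h g : TropPoly R n) : Prop :=
  ∀ a, f a = h.eval a / g.eval a

theorem TropPoly.exists_mul [IsOrderedMonoid R] (p q : TropPoly R n) :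
    ∃ r : TropPoly R n, ∀ a, r.eval a = p.eval a * q.eval a := by
  classical
  have key : ∀ (m m' : Monom R n) (a : Fin n → R),
      Monom.eval (m.1 + m'.1, m.2 * m'.2) a = m.eval a * m'.eval a := by
    intro m m' a
    simp only [Monom.eval, Pi.add_apply, pow_add, Finset.prod_mul_distrib]
    exact mul_mul_mul_comm _ _ _ _
  refine ⟨⟨(p.monoms ×ˢ q.monoms).image
    (fun x => ((x.1.1 + x.2.1, x.1.2 * x.2.2) : Monom R n)),
    (p.nonempty.product q.nonempty).image _⟩, fun a => le_antisymm ?_ ?_⟩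
  · refine Finset.sup'_le _ _ fun m hm => ?_
    obtain ⟨⟨m₁, m₂⟩, hx, rfl⟩ := Finset.mem_image.1 hm
    rw [Finset.mem_product] at hx
    rw [key]
    exact mul_le_mul' (Finset.le_sup' (fun m : Monom R n => m.eval a) hx.1)
      (Finset.le_sup' (fun m : Monom R n => m.eval a) hx.2)
  · obtain ⟨m₁, h₁, e₁⟩ := Finset.exists_mem_eq_sup' p.nonempty fun m : Monom R n => m.eval a
    obtain ⟨m₂, h₂, e₂⟩ := Finset.exists_mem_eq_sup' q.nonempty fun m : Monom R n => m.eval a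
    have e₁' : p.eval a = m₁.eval a := e₁
    have e₂' : q.eval a = m₂.eval a := e₂
    rw [e₁', e₂', ← key]
    have hm : ((m₁.1 + m₂.1, m₁.2 * m₂.2) : Monom R n) ∈ (p.monoms ×ˢ q.monoms).image
        (fun x => ((x.1.1 + x.2.1, x.1.2 * x.2.2) : Monom R n)) :=
      Finset.mem_image.2 ⟨(m₁, m₂), Finset.mem_product.2 ⟨h₁, h₂⟩, rfl⟩
    exact Finset.le_sup' (fun m : Monom R n => m.eval a) hm

theorem TropPoly.exists_sup (p q : TropPoly R n) :
    ∃ r : TropPoly R n, ∀ a, r.eval a = p.eval a ⊔ q.eval a := by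
  classical
  refine ⟨⟨p.monoms ∪ q.monoms, p.nonempty.mono Finset.subset_union_left⟩, fun a => ?_⟩
  exact Finset.sup'_union p.nonempty q.nonempty _

theorem TropPoly.exists_one : ∃ r : TropPoly R n, ∀ a, r.eval a = 1 :=
  ⟨⟨{(0, 1)}, Finset.singleton_nonempty _⟩, fun a => by simp [TropPoly.eval, Monom.eval]⟩

variable (R n) in
/-- The semifield of fractions `R(x₁, …, xₙ)`, as a subsemifield of the semifield of functions
`Rⁿ → R` with pointwise multiplication and addition `⊔`. -/
def ratFun [IsOrderedMonoid R] : Subsemifield ((Fin n → R) → R) where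
  carrier := {f | ∃ h g : TropPoly R n, IsFraction f h g}
  one_mem' := by
    obtain ⟨u, hu⟩ := TropPoly.exists_one (R := R) (n := n)
    exact ⟨u, u, fun a => by simp⟩
  mul_mem' := by
    rintro f f' ⟨h, g, e⟩ ⟨h', g', e'⟩
    obtain ⟨u, hu⟩ := h.exists_mul h'
    obtain ⟨v, hv⟩ := g.exists_mul g'
    exact ⟨u, v, fun a => by rw [Pi.mul_apply, e, e', hu, hv, div_mul_div_comm]⟩
  inv_mem' := by
    rintro f ⟨h, g, e⟩
    exact ⟨g, h, fun a => by rw [Pi.inv_apply, e, inv_div]⟩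
  sup_mem' := by
    rintro f f' ⟨h, g, e⟩ ⟨h', g', e'⟩
    obtain ⟨u, hu⟩ := h.exists_mul g'
    obtain ⟨u', hu'⟩ := h'.exists_mul g
    obtain ⟨w, hw⟩ := u.exists_sup u'
    obtain ⟨v, hv⟩ := g.exists_mul g'
    refine ⟨w, v, fun a => ?_⟩
    have h₁ : f a = u.eval a / v.eval a := by
      rw [e, hu, hv, mul_div_mul_right_eq_div]
    have h₂ : f' a = u'.eval a / v.eval a := by
      rw [e', hu', hv, mul_comm (g.eval a), mul_div_mul_right_eq_div]
    rw [Pi.sup_apply, h₁, h₂, hw]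
    simp only [div_eq_mul_inv]
    exact (max_mul_mul_right _ _ _)

variable (R n) in
/-- `⟨R⟩`: the kernel of `R(x₁, …, xₙ)` generated by the constants, a semifield in its own right. -/
def constKernel [IsOrderedMonoid R] : Subsemifield ((Fin n → R) → R) where
  toSubgroup := kernelSpan (ratFun R n) (Set.range fun c : R => Function.const (Fin n → R) c)
  sup_mem' := kernelSpan_sup_mem _ _

/-- `f` is regular: it is a fraction `h / g` such that at every point some monomial of `h` and some
monomial of `g`, not equal to each other, attain the values of `h` and of `g`. -/
def IsRegular (f : (Fin n → R) → R) : Prop :=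
  ∃ h g : TropPoly R n, IsFraction f h g ∧
    ∀ a, ∃ m ∈ h.monoms, ∃ m' ∈ g.monoms,
      h.eval a = m.eval a ∧ g.eval a = m'.eval a ∧ m ≠ m'

/-- The regular principal kernels of a semifield `U` of functions: the principal kernels generated
by a regular element. -/
def RegPCon (U : Subsemifield ((Fin n → R) → R)) : Set (Subgroup ((Fin n → R) → R)) :=
  {K | ∃ f ∈ U.toSubgroup, IsRegular f ∧ K = kernelSpan U {f}}

/-- The skeleton of a kernel. -/
def Skel (K : Subgroup ((Fin n → R) → R)) : Set (Fin n → R) :=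
  {a | ∀ f ∈ K, f a = 1}

/-- `Ker_U(Z)`: the elements of `U` that are `1` on `Z`. -/
def Ker (U : Subsemifield ((Fin n → R) → R)) (Z : Set (Fin n → R)) :
    Subgroup ((Fin n → R) → R) where
  carrier := {f | f ∈ U.toSubgroup ∧ ∀ a ∈ Z, f a = 1}
  one_mem' := ⟨one_mem _, fun _ _ => rfl⟩
  mul_mem' := fun hf hg =>
    ⟨mul_mem hf.1 hg.1, fun a ha => by rw [Pi.mul_apply, hf.2 a ha, hg.2 a ha, one_mul]⟩
  inv_mem' := fun hf => ⟨inv_mem hf.1, fun a ha => by rw [Pi.inv_apply, hf.2 a ha, inv_one]⟩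

end Fractions

/-- A set of subgroups closed under the product `⊔` and the intersection `⊓` of subgroups, with an
order-reversing bijection `F` onto a set of point sets closed under `∩` and `∪`, that turns products
into intersections and intersections into unions. -/
structure IsLatticeCorrespondence {S X : Type*} [CommGroup S]
    (F : Subgroup S → Set X) (P : Set (Subgroup S)) (L : Set (Set X)) : Prop where
  mul_mem : ∀ K ∈ P, ∀ K' ∈ P, K ⊔ K' ∈ P
  inter_mem : ∀ K ∈ P, ∀ K' ∈ P, K ⊓ K' ∈ P
  locus_inter_mem : ∀ Z ∈ L, ∀ Z' ∈ L, Z ∩ Z' ∈ L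
  locus_union_mem : ∀ Z ∈ L, ∀ Z' ∈ L, Z ∪ Z' ∈ L
  bijOn : Set.BijOn F P L
  map_mul : ∀ K ∈ P, ∀ K' ∈ P, F (K ⊔ K') = F K ∩ F K'
  map_inter : ∀ K ∈ P, ∀ K' ∈ P, F (K ⊓ K') = F K ∪ F K'
  le_iff : ∀ K ∈ P, ∀ K' ∈ P, K ≤ K' ↔ F K' ⊆ F K

end TropKernel

end

/-! Both sides of the correspondence are parametrised by the same family of point sets, the zero
sets `{f = 1}` of fractions (`fracLoci`).

On the side of kernels this rests on a Nullstellensatz. The semifield `⟨R⟩` consists of the bounded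
fractions (`constKernel_toSubgroup`). If `f`, `g` are bounded fractions and `g = 1` wherever `f =
1`, then `|g| ≤ |f| ^ k` for some `k` (`exists_mabs_le_pow`). Kernels are convex, so `⟨f⟩` is the
whole of `Ker {f = 1}` (`kernelSpan_singleton`). For the inequality, read the group additively and
cut the space into finitely many polyhedra on which `|f|` and `|g|` are affine. On each of them
Motzkin's transposition theorem, valid over any nontrivial divisible ordered abelian group, gives a
linear inequality between the two; boundedness of `g` and the archimedean property turn it into a
multiple of `|f|`.

On the side of loci, a corner root condition says that no tangible monomial strictly dominates all
others. This is a finite combination of half-spaces, hence a zero set of a fraction; conversely `h /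
g = 1` means that each monomial of `h` is at most `g` and vice versa, and half-spaces of this kind
are corner loci of polynomials with ghost terms (`fcl_eq_fracLoci`).

In the regular case both families become the zero sets contained in the corners of a single
polynomial `p` (`isRegular_iff`, `frcl_eq_thinLoci`): within these corners, products with `p` make
half-spaces expressible by tangible polynomials. -/

namespace TropKernel

/-! ### Fourier–Motzkin elimination over a divisible ordered group -/

/-- Affine forms with integer slopes and constant term in `A`. -/
abbrev AffineForm (ι A : Type*) := (ι → ℤ) × A

/-- `0 ≤ a`, or `0 < a` if `b` is set. -/
def SignCond {A : Type*} [Zero A] [Preorder A] (b : Bool) (a : A) : Prop :=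
  0 ≤ a ∧ (b = true → 0 < a)

/-- Nonnegative integer combinations of the constraints in `H` and of constants; the flag tells
whether the resulting inequality is strict. -/
inductive Derivable {ι A : Type*} [AddCommGroup A] [LinearOrder A]
    (H : Set (AffineForm ι A × Bool)) : AffineForm ι A → Bool → Prop
  | hyp {l b} : (l, b) ∈ H → Derivable H l b
  | add {l l' b b'} : Derivable H l b → Derivable H l' b' → Derivable H (l + l') (b || b')
  | const {c b} : SignCond b c → Derivable H (0, c) b

section FourierMotzkin

variable {ι A : Type*} [AddCommGroup A]

section Eval

variable [Fintype ι]

def AffineForm.eval (l : AffineForm ι A) (x : ι → A) : A := ∑ i, l.1 i • x i + l.2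

theorem AffineForm.eval_add (l l' : AffineForm ι A) (x : ι → A) :
    (l + l').eval x = l.eval x + l'.eval x := by
  simp only [AffineForm.eval, Prod.fst_add, Prod.snd_add, Pi.add_apply, add_smul,
    Finset.sum_add_distrib]
  abel

theorem AffineForm.eval_neg (l : AffineForm ι A) (x : ι → A) :
    (-l).eval x = -l.eval x := by
  simp only [AffineForm.eval, Prod.fst_neg, Prod.snd_neg, Pi.neg_apply, neg_smul,
    Finset.sum_neg_distrib]
  abel

theorem AffineForm.eval_sub (l l' : AffineForm ι A) (x : ι → A) :
    (l - l').eval x = l.eval x - l'.eval x := by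
  rw [sub_eq_add_neg, AffineForm.eval_add, AffineForm.eval_neg, sub_eq_add_neg]

theorem AffineForm.eval_nsmul (k : ℕ) (l : AffineForm ι A) (x : ι → A) :
    (k • l).eval x = k • l.eval x := by
  induction k with
  | zero => simp [AffineForm.eval]
  | succ k ih => rw [succ_nsmul, succ_nsmul, AffineForm.eval_add, ih]

theorem AffineForm.eval_update [DecidableEq ι] (l : AffineForm ι A) (x : ι → A) (i : ι) (t : A) :
    l.eval (Function.update x i t) = l.1 i • t + l.eval (Function.update x i 0) := by
  simp only [AffineForm.eval]
  rw [← Finset.add_sum_erase _ _ (Finset.mem_univ i),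
    ← Finset.add_sum_erase (a := i) (f := fun j => l.1 j • Function.update x i 0 j) _
      (Finset.mem_univ i)]
  have : ∀ s : A, ∑ j ∈ Finset.univ.erase i, l.1 j • Function.update x i s j
      = ∑ j ∈ Finset.univ.erase i, l.1 j • x j := fun s =>
    Finset.sum_congr rfl fun j hj => by
      rw [Function.update_of_ne (Finset.ne_of_mem_erase hj)]
  simp only [this, Function.update_self, smul_zero, zero_add, add_assoc]

end Eval

variable [LinearOrder A]

theorem Derivable.trans {H H' : Set (AffineForm ι A × Bool)}
    (h : ∀ p ∈ H', Derivable H p.1 p.2) {l : AffineForm ι A} {b : Bool} (hl : Derivable H' l b) :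
    Derivable H l b := by
  induction hl with
  | hyp hm => exact h _ hm
  | add _ _ h₁ h₂ => exact h₁.add h₂
  | const hc => exact .const hc

theorem Derivable.nsmul {H : Set (AffineForm ι A × Bool)} {l : AffineForm ι A} {b : Bool}
    (h : Derivable H l b) {k : ℕ} (hk : k ≠ 0) : Derivable H (k • l) b := by
  induction k with
  | zero => exact absurd rfl hk
  | succ k ih =>
    rcases eq_or_ne k 0 with rfl | hk'
    · simpa using h
    · rw [succ_nsmul]
      simpa using (ih hk').add h

variable [IsOrderedAddMonoid A]

theorem denselyOrdered_of_divisible (hdiv : ∀ k : ℕ, k ≠ 0 → ∀ a : A, ∃ b : A, k • b = a) :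
    DenselyOrdered A where
  dense a b hab := by
    obtain ⟨c, hc⟩ := hdiv 2 two_ne_zero (a + b)
    rw [two_nsmul] at hc
    refine ⟨c, ?_, ?_⟩
    · by_contra! h
      exact absurd (add_le_add h h) (by rw [hc]; exact not_le.2 (add_lt_add_right hab a))
    · by_contra! h
      exact absurd (add_le_add h h) (by rw [hc]; exact not_le.2 (add_lt_add_left hab b))

/-- One variable: finitely many constraints `k t + v ≥ 0` or `> 0` are solvable as soon as each
pair of opposite constraints is. -/
theorem exists_signCond_of_pairwise [Nontrivial A]
    (hdiv : ∀ k : ℕ, k ≠ 0 → ∀ a : A, ∃ b : A, k • b = a)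
    {T : Set ((ℤ × A) × Bool)} (hT : T.Finite)
    (hzero : ∀ p ∈ T, p.1.1 = 0 → SignCond p.2 p.1.2)
    (hpair : ∀ p ∈ T, ∀ q ∈ T, 0 < p.1.1 → q.1.1 < 0 →
      SignCond (p.2 || q.2) ((-q.1.1) • p.1.2 + p.1.1 • q.1.2)) :
    ∃ t : A, ∀ p ∈ T, SignCond p.2 (p.1.1 • t + p.1.2) := by
  classical
  -- `r p` is the zero of `k t + v`. Positive slopes make it a lower bound for `t`, negative slopes
  -- an upper bound.
  have hroot : ∀ p : (ℤ × A) × Bool, ∃ r : A, p.1.1 ≠ 0 → p.1.1 • r = -p.1.2 := by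
    rintro ⟨⟨k, v⟩, b⟩
    rcases eq_or_ne k 0 with rfl | hk
    · exact ⟨0, fun h => absurd rfl h⟩
    · obtain ⟨r, hr⟩ := hdiv k.natAbs (Int.natAbs_ne_zero.2 hk) (-v)
      rcases Int.natAbs_eq k with h | h
      · exact ⟨r, fun _ => by rw [← hr, ← natCast_zsmul, ← h]⟩
      · exact ⟨-r, fun _ => by
          simp only
          rw [← hr, ← natCast_zsmul, smul_neg, ← neg_smul]
          congr 1
          lia⟩
  choose r hr using hroot
  have hval : ∀ p : (ℤ × A) × Bool, p.1.1 ≠ 0 → ∀ t, p.1.1 • t + p.1.2 = p.1.1 • (t - r p) := by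
    intro p hp t
    rw [smul_sub, hr p hp, sub_neg_eq_add]
  have hle : ∀ p ∈ T, ∀ q ∈ T, 0 < p.1.1 → q.1.1 < 0 →
      r p ≤ r q ∧ ((p.2 || q.2) = true → r p < r q) := by
    intro p hp q hq hp0 hq0
    have e : (-q.1.1) • p.1.2 + p.1.1 • q.1.2 = (-q.1.1 * p.1.1) • (r q - r p) := by
      have e₁ : p.1.2 = -(p.1.1 • r p) := by rw [hr p hp0.ne', neg_neg]
      have e₂ : q.1.2 = -(q.1.1 • r q) := by rw [hr q hq0.ne, neg_neg]
      rw [e₁, e₂]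
      module
    have hpos : 0 < -q.1.1 * p.1.1 := mul_pos (neg_pos.2 hq0) hp0
    have h := hpair p hp q hq hp0 hq0
    rw [SignCond, e] at h
    refine ⟨?_, fun hb => ?_⟩
    · rw [← sub_nonneg, ← zsmul_le_zsmul_iff_right hpos, smul_zero]
      exact h.1
    · rw [← sub_pos, ← zsmul_lt_zsmul_iff_right hpos, smul_zero]
      exact h.2 hb
  suffices ∃ t : A, (∀ p ∈ T, 0 < p.1.1 → r p ≤ t ∧ (p.2 = true → r p < t)) ∧
      ∀ p ∈ T, p.1.1 < 0 → t ≤ r p ∧ (p.2 = true → t < r p) by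
    obtain ⟨t, ht₁, ht₂⟩ := this
    refine ⟨t, fun p hp => ?_⟩
    rcases lt_trichotomy p.1.1 0 with h | h | h
    · obtain ⟨h₁, h₂⟩ := ht₂ p hp h
      rw [hval p h.ne, show p.1.1 • (t - r p) = (-p.1.1) • (r p - t) by module]
      exact ⟨zsmul_nonneg (sub_nonneg.2 h₁) (by lia),
        fun hb => zsmul_pos (sub_pos.2 (h₂ hb)) (by lia)⟩
    · rw [h, zero_smul, zero_add]
      exact hzero p hp h
    · obtain ⟨h₁, h₂⟩ := ht₁ p hp h
      rw [hval p h.ne']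
      exact ⟨zsmul_nonneg (sub_nonneg.2 h₁) h.le, fun hb => zsmul_pos (sub_pos.2 (h₂ hb)) h⟩
  -- If a lower bound meets an upper bound, `t` must be their common value, and `hle` takes care of
  -- strictness. Otherwise all lower bounds are strictly below all upper bounds and density yields a
  -- `t` that satisfies everything strictly.
  by_cases heq : ∃ p ∈ T, ∃ q ∈ T, 0 < p.1.1 ∧ q.1.1 < 0 ∧ r p = r q
  · obtain ⟨p, hp, q, hq, hp0, hq0, he⟩ := heq
    refine ⟨r p, fun p' hp' hp0' => ?_, fun q' hq' hq0' => ?_⟩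
    · rw [he]
      exact ⟨(hle p' hp' q hq hp0' hq0).1, fun hb => (hle p' hp' q hq hp0' hq0).2 (by simp [hb])⟩
    · exact ⟨(hle p hp q' hq' hp0 hq0').1, fun hb => (hle p hp q' hq' hp0 hq0').2 (by simp [hb])⟩
  · push Not at heq
    have := denselyOrdered_of_divisible hdiv
    obtain ⟨t, ht₁, ht₂⟩ := Order.exists_between_finsets
      ((hT.toFinset.filter fun p => 0 < p.1.1).image r)
      ((hT.toFinset.filter fun p => p.1.1 < 0).image r) (by
        simp only [Finset.mem_image, Finset.mem_filter, Set.Finite.mem_toFinset]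
        rintro _ ⟨p, ⟨hp, hp0⟩, rfl⟩ _ ⟨q, ⟨hq, hq0⟩, rfl⟩
        exact lt_of_le_of_ne (hle p hp q hq hp0 hq0).1 (heq p hp q hq hp0 hq0))
    simp only [Finset.mem_image, Finset.mem_filter, Set.Finite.mem_toFinset] at ht₁ ht₂
    exact ⟨t, fun p hp h => ⟨(ht₁ _ ⟨p, ⟨hp, h⟩, rfl⟩).le, fun _ => ht₁ _ ⟨p, ⟨hp, h⟩, rfl⟩⟩,
      fun p hp h => ⟨(ht₂ _ ⟨p, ⟨hp, h⟩, rfl⟩).le, fun _ => ht₂ _ ⟨p, ⟨hp, h⟩, rfl⟩⟩⟩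

/-- Motzkin's transposition theorem: an infeasible finite system of affine inequalities has a
combination that reads `0 > 0`. -/
theorem exists_point_or_derivable [Fintype ι] [Nontrivial A]
    (hdiv : ∀ k : ℕ, k ≠ 0 → ∀ a : A, ∃ b : A, k • b = a)
    {H : Set (AffineForm ι A × Bool)} (hH : H.Finite) :
    (∃ x : ι → A, ∀ p ∈ H, SignCond p.2 (p.1.eval x)) ∨ Derivable H 0 true := by
  classical
  -- Induction on a set `s` containing the variables that occur in the system; each step eliminates
  -- one of them.
  suffices ∀ s : Finset ι, ∀ H : Set (AffineForm ι A × Bool), H.Finite →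
      (∀ p ∈ H, ∀ i ∉ s, p.1.1 i = 0) →
      (∃ x : ι → A, ∀ p ∈ H, SignCond p.2 (p.1.eval x)) ∨ Derivable H 0 true from
    this Finset.univ H hH fun _ _ i hi => absurd (Finset.mem_univ i) hi
  intro s
  induction s using Finset.induction_on with
  | empty =>
    intro H hH hs
    by_cases h : ∀ p ∈ H, SignCond p.2 (p.1.eval 0)
    · exact Or.inl ⟨0, h⟩
    · push Not at h
      obtain ⟨⟨⟨u, c⟩, b⟩, hp, hn⟩ := h
      have hu : u = 0 := funext fun i => hs _ hp i (Finset.notMem_empty i)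
      subst hu
      have hc : AffineForm.eval ((0, c) : AffineForm ι A) 0 = c := by simp [AffineForm.eval]
      simp only [hc] at hn
      -- The negation of the violated constraint on `c` has the opposite strictness, so adding the
      -- two gives `0` with flag `b || !b = true`.
      have hd : SignCond (!b) (-c) := by
        cases b
        · have : c < 0 := by simpa [SignCond] using hn
          exact ⟨(neg_pos.2 this).le, fun _ => neg_pos.2 this⟩
        · have : ¬ 0 < c := fun h => hn ⟨h.le, fun _ => h⟩
          exact ⟨neg_nonneg.2 (not_lt.1 this), by simp⟩
      right
      have := (Derivable.hyp hp).add (Derivable.const (H := H) hd)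
      simpa [← Prod.zero_eq_mk] using this
  | insert i s hi ih =>
    intro H hH hs
    -- For opposite slopes at `i`, the positive combination in which variable `i` cancels.
    let comb : AffineForm ι A × Bool → AffineForm ι A × Bool → AffineForm ι A × Bool :=
      fun p q => ((-q.1.1 i).toNat • p.1 + (p.1.1 i).toNat • q.1, p.2 || q.2)
    let P : Set (AffineForm ι A × Bool) := {p ∈ H | 0 < p.1.1 i}
    let N : Set (AffineForm ι A × Bool) := {p ∈ H | p.1.1 i < 0}
    let Z : Set (AffineForm ι A × Bool) := {p ∈ H | p.1.1 i = 0}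
    have hfin : (Z ∪ image2 comb P N).Finite :=
      (hH.subset (sep_subset _ _)).union
        ((hH.subset (sep_subset _ _)).image2 _ (hH.subset (sep_subset _ _)))
    have hsupp : ∀ p ∈ Z ∪ image2 comb P N, ∀ j ∉ s, p.1.1 j = 0 := by
      rintro p (hp | ⟨p, hp, q, hq, rfl⟩) j hj
      · rcases eq_or_ne j i with rfl | hji
        · exact hp.2
        · exact hs p hp.1 j (by simp [hji, hj])
      · have e : (comb p q).1.1 j = (-q.1.1 i) * p.1.1 j + (p.1.1 i) * q.1.1 j := by
          have h₁ : ((-q.1.1 i).toNat : ℤ) = -q.1.1 i := Int.toNat_of_nonneg (by have := hq.2; lia)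
          have h₂ : ((p.1.1 i).toNat : ℤ) = p.1.1 i := Int.toNat_of_nonneg hp.2.le
          rw [← h₁, ← h₂]
          simp [comb]
        rw [e]
        rcases eq_or_ne j i with rfl | hji
        · ring
        · rw [hs p hp.1 j (by simp [hji, hj]), hs q hq.1 j (by simp [hji, hj])]
          ring
    rcases ih _ hfin hsupp with ⟨y, hy⟩ | hd
    · left
      -- With the other coordinates of `y` frozen, the system is one in the coordinate `i` alone;
      -- the eliminated constraints are exactly its pairwise compatibility conditions.
      obtain ⟨t, ht⟩ := exists_signCond_of_pairwise hdiv
        (T := (fun p : AffineForm ι A × Bool =>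
          ((p.1.1 i, p.1.eval (Function.update y i 0)), p.2)) '' H) (hH.image _) (by
          rintro _ ⟨p, hp, rfl⟩ h0
          have := hy p (Or.inl ⟨hp, h0⟩)
          have e := p.1.eval_update y i (y i)
          simp only at h0
          rw [Function.update_eq_self, h0, zero_smul, zero_add] at e
          rw [e] at this
          exact this) (by
          rintro _ ⟨p, hp, rfl⟩ _ ⟨q, hq, rfl⟩ hp0 hq0
          simp only at hp0 hq0 ⊢
          have := hy _ (Or.inr ⟨p, ⟨hp, hp0⟩, q, ⟨hq, hq0⟩, rfl⟩)
          have e₁ := p.1.eval_update y i (y i)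
          have e₂ := q.1.eval_update y i (y i)
          have h₁ : ((-q.1.1 i).toNat : ℤ) = -q.1.1 i := Int.toNat_of_nonneg (by lia)
          have h₂ : ((p.1.1 i).toNat : ℤ) = p.1.1 i := Int.toNat_of_nonneg hp0.le
          rw [Function.update_eq_self] at e₁ e₂
          simp only [comb, AffineForm.eval_add, AffineForm.eval_nsmul] at this
          rw [← natCast_zsmul, ← natCast_zsmul, h₁, h₂, e₁, e₂] at this
          convert this using 1
          module)
      refine ⟨Function.update y i t, fun p hp => ?_⟩
      rw [AffineForm.eval_update]
      exact ht _ ⟨p, hp, rfl⟩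
    · right
      refine hd.trans ?_
      rintro p (hp | ⟨p, hp, q, hq, rfl⟩)
      · exact .hyp hp.1
      · exact ((Derivable.hyp hp.1).nsmul (by have := hq.2; lia)).add
          ((Derivable.hyp hq.1).nsmul (by have := hp.2; lia))

end FourierMotzkin

/-! ### The Nullstellensatz for fractions -/

/-- The hypothesis makes the system `l ≥ 0`, `-f ≥ 0`, `g > 0` infeasible, so `0 > 0` is derivable.
In the derivation, `α` and `μ` count the uses of `g` and of `-f`, and `c` sums the constants.
Strictness can only stem from `g` or from a positive constant, whence `α ≠ 0 ∨ 0 < c`. -/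
theorem exists_certificate {ι A : Type*} [Fintype ι] [AddCommGroup A] [LinearOrder A]
    [IsOrderedAddMonoid A] [Nontrivial A] (hdiv : ∀ k : ℕ, k ≠ 0 → ∀ a : A, ∃ b : A, k • b = a)
    {L : Set (AffineForm ι A)} (hL : L.Finite) (f g : AffineForm ι A)
    (h : ∀ x, (∀ l ∈ L, 0 ≤ l.eval x) → f.eval x ≤ 0 → g.eval x ≤ 0) :
    ∃ (α μ : ℕ) (c : A), 0 ≤ c ∧ (α ≠ 0 ∨ 0 < c) ∧
      ∀ x, (∀ l ∈ L, 0 ≤ l.eval x) → α • g.eval x + c ≤ μ • f.eval x := by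
  have hH : (((fun l : AffineForm ι A => (l, false)) '' L) ∪ {(-f, false), (g, true)}).Finite :=
    (hL.image _).union (toFinite _)
  rcases exists_point_or_derivable hdiv hH with ⟨x, hx⟩ | hd
  · have h₁ : 0 ≤ -f.eval x := by
      rw [← AffineForm.eval_neg]
      exact (hx (-f, false) (by simp)).1
    have h₂ : 0 < g.eval x := (hx (g, true) (by simp)).2 rfl
    exact absurd (h x (fun l hl => (hx (l, false) (Or.inl ⟨l, hl, rfl⟩)).1) (neg_nonneg.1 h₁))
      (not_le.2 h₂)
  · have key : ∀ l b, Derivable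
        (((fun l : AffineForm ι A => (l, false)) '' L) ∪ {(-f, false), (g, true)}) l b →
        ∃ (α μ : ℕ) (c : A), 0 ≤ c ∧ (b = true → α ≠ 0 ∨ 0 < c) ∧
          ∀ x, (∀ l ∈ L, 0 ≤ l.eval x) → α • g.eval x + c ≤ μ • f.eval x + l.eval x := by
      intro l b hl
      induction hl with
      | @hyp l b hm =>
        rcases hm with ⟨l', hl', he⟩ | hm | hm
        · simp only [Prod.mk.injEq] at he
          obtain ⟨rfl, rfl⟩ := he
          exact ⟨0, 0, 0, le_rfl, by simp, fun x hx => by simpa using hx _ hl'⟩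
        · simp only [Prod.mk.injEq] at hm
          obtain ⟨rfl, rfl⟩ := hm
          exact ⟨0, 1, 0, le_rfl, by simp, fun x hx => by simp [AffineForm.eval_neg]⟩
        · simp only [mem_singleton_iff, Prod.mk.injEq] at hm
          obtain ⟨rfl, rfl⟩ := hm
          exact ⟨1, 0, 0, le_rfl, by simp, fun x hx => by simp⟩
      | @add l l' b b' _ _ ih₁ ih₂ =>
        obtain ⟨α, μ, c, hc, hb, hx⟩ := ih₁
        obtain ⟨α', μ', c', hc', hb', hx'⟩ := ih₂
        refine ⟨α + α', μ + μ', c + c', add_nonneg hc hc', fun h => ?_, fun x hL => ?_⟩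
        · rw [Bool.or_eq_true] at h
          rcases h with h | h
          · rcases hb h with h | h
            · exact Or.inl (by lia)
            · exact Or.inr (add_pos_of_pos_of_nonneg h hc')
          · rcases hb' h with h | h
            · exact Or.inl (by lia)
            · exact Or.inr (add_pos_of_nonneg_of_pos hc h)
        · have := add_le_add (hx x hL) (hx' x hL)
          rw [AffineForm.eval_add]
          convert this using 1 <;> module
      | @const c b hc =>
        exact ⟨0, 0, c, hc.1, fun h => Or.inr (hc.2 h), fun x _ => by simp [AffineForm.eval]⟩
    obtain ⟨α, μ, c, hc, hb, hx⟩ := key _ _ hd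
    refine ⟨α, μ, c, hc, hb rfl, fun x hL => ?_⟩
    simpa [AffineForm.eval] using hx x hL

/-- On a polyhedron, a bounded nonnegative affine form that vanishes where the nonnegative affine
form `f` does is at most a multiple of `f`. -/
theorem exists_le_nsmul {ι A : Type*} [Fintype ι] [AddCommGroup A] [LinearOrder A]
    [IsOrderedAddMonoid A] [Nontrivial A] [Archimedean A]
    (hdiv : ∀ k : ℕ, k ≠ 0 → ∀ a : A, ∃ b : A, k • b = a)
    {L : Set (AffineForm ι A)} (hL : L.Finite) (f g : AffineForm ι A) (M : A)
    (hg : ∀ x, (∀ l ∈ L, 0 ≤ l.eval x) → 0 ≤ g.eval x ∧ g.eval x ≤ M)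
    (h : ∀ x, (∀ l ∈ L, 0 ≤ l.eval x) → f.eval x ≤ 0 → g.eval x ≤ 0) :
    ∃ k : ℕ, ∀ x, (∀ l ∈ L, 0 ≤ l.eval x) → g.eval x ≤ k • f.eval x := by
  obtain ⟨α, μ, c, hc, hα | hc', hx⟩ := exists_certificate hdiv hL f g h
  · refine ⟨μ, fun x hL => le_trans ?_ (hx x hL)⟩
    have h₁ : 1 • g.eval x ≤ α • g.eval x :=
      nsmul_le_nsmul_left (hg x hL).1 (Nat.one_le_iff_ne_zero.2 hα)
    rw [one_nsmul] at h₁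
    exact h₁.trans (le_add_of_nonneg_right hc)
  -- Here `μ • f` is bounded below by the positive constant `c`, and a multiple of `c` exceeds the
  -- bound `M` of `g`.
  · obtain ⟨N, hN⟩ := Archimedean.arch M hc'
    refine ⟨N * μ, fun x hL => (hg x hL).2.trans (hN.trans ?_)⟩
    rw [mul_nsmul']
    exact nsmul_le_nsmul_right
      ((le_add_of_nonneg_left (nsmul_nonneg (hg x hL).1 α)).trans (hx x hL)) N

section Fractions

variable {R : Type*} [CommGroup R] {n : ℕ}

/-- `Additive R` plays the part of logarithmic coordinates, in which a monomial is affine with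
natural slopes. -/
def Monom.toForm (m : Monom R n) : AffineForm (Fin n) (Additive R) :=
  (fun i => (m.1 i : ℤ), Additive.ofMul m.2)

theorem Monom.eval_toForm (m : Monom R n) (x : Fin n → Additive R) :
    m.toForm.eval x = Additive.ofMul (m.eval fun i => (x i).toMul) := by
  simp [AffineForm.eval, Monom.toForm, Monom.eval, ofMul_mul, ofMul_prod, ofMul_pow, add_comm]

variable [LinearOrder R]

theorem TropPoly.le_eval (p : TropPoly R n) {m : Monom R n} (hm : m ∈ p.monoms) (a : Fin n → R) :
    m.eval a ≤ p.eval a :=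
  Finset.le_sup' (fun m : Monom R n => m.eval a) hm

theorem TropPoly.exists_eval_eq (p : TropPoly R n) (a : Fin n → R) :
    ∃ m ∈ p.monoms, p.eval a = m.eval a :=
  Finset.exists_mem_eq_sup' p.nonempty fun m : Monom R n => m.eval a

theorem TropPoly.eval_le_iff (p : TropPoly R n) {a : Fin n → R} {c : R} :
    p.eval a ≤ c ↔ ∀ m ∈ p.monoms, m.eval a ≤ c :=
  Finset.sup'_le_iff _ _

/-- Write `f = p / q` and `g = u / v`. Fixing a dominating monomial in each of the four polynomials
cuts out a polyhedron on which both fractions are affine, so `exists_le_nsmul` applies; there are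
finitely many such cells, and they cover the space. -/
theorem exists_le_pow_of_eq_one [IsOrderedMonoid R] [Nontrivial R] [MulArchimedean R]
    (hdiv : ∀ k : ℕ, k ≠ 0 → ∀ a : R, ∃ b : R, b ^ k = a) {f g : (Fin n → R) → R}
    (hf : f ∈ (ratFun R n).toSubgroup) (hg : g ∈ (ratFun R n).toSubgroup)
    (hf1 : ∀ a, 1 ≤ f a) (hg1 : ∀ a, 1 ≤ g a) {M : R} (hM : ∀ a, g a ≤ M)
    (h : ∀ a, f a = 1 → g a = 1) : ∃ k : ℕ, ∀ a, g a ≤ f a ^ k := by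
  classical
  obtain ⟨p, q, hpq⟩ := hf
  obtain ⟨u, v, huv⟩ := hg
  have cell : ∀ (r : TropPoly R n) (m : Monom R n), m ∈ r.monoms → ∀ a,
      (∀ m' ∈ r.monoms, m'.eval a ≤ m.eval a) → r.eval a = m.eval a := fun r m hm a h =>
    le_antisymm (r.eval_le_iff.2 h) (r.le_eval hm a)
  have key : ∀ σ : (Monom R n × Monom R n) × Monom R n × Monom R n, ∃ k : ℕ,
      σ ∈ (p.monoms ×ˢ q.monoms) ×ˢ u.monoms ×ˢ v.monoms → ∀ a, p.eval a = σ.1.1.eval a →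
        q.eval a = σ.1.2.eval a → u.eval a = σ.2.1.eval a → v.eval a = σ.2.2.eval a →
        g a ≤ f a ^ k := by
    rintro ⟨⟨mp, mq⟩, mu, mv⟩
    by_cases hσ : ((mp, mq), mu, mv) ∈ (p.monoms ×ˢ q.monoms) ×ˢ u.monoms ×ˢ v.monoms
    swap
    · exact ⟨0, fun h => absurd h hσ⟩
    simp only [Finset.mem_product] at hσ
    -- The constraints saying that `m` dominates `r`.
    let dom (r : TropPoly R n) (m : Monom R n) : Set (AffineForm (Fin n) (Additive R)) :=
      (fun m' : Monom R n => m.toForm - m'.toForm) '' r.monoms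
    have hdom : ∀ r m, (dom r m).Finite := fun r m => r.monoms.finite_toSet.image _
    have hmem : ∀ (r : TropPoly R n) (m : Monom R n) (a : Fin n → R),
        (∀ l ∈ dom r m, 0 ≤ l.eval fun i => Additive.ofMul (a i)) ↔
          ∀ m' ∈ r.monoms, m'.eval a ≤ m.eval a := by
      intro r m a
      simp only [dom, forall_mem_image, AffineForm.eval_sub, Monom.eval_toForm, sub_nonneg]
      exact Iff.rfl
    let L := (dom p mp ∪ dom q mq) ∪ (dom u mu ∪ dom v mv)
    have hmemL : ∀ a : Fin n → R, (∀ l ∈ L, 0 ≤ l.eval fun i => Additive.ofMul (a i)) ↔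
        ((∀ m' ∈ p.monoms, m'.eval a ≤ mp.eval a) ∧ (∀ m' ∈ q.monoms, m'.eval a ≤ mq.eval a)) ∧
        ((∀ m' ∈ u.monoms, m'.eval a ≤ mu.eval a) ∧ (∀ m' ∈ v.monoms, m'.eval a ≤ mv.eval a)) := by
      intro a
      simp only [← hmem, L, mem_union, or_imp, forall_and]
    have hev : ∀ a : Fin n → R, (∀ l ∈ L, 0 ≤ l.eval fun i => Additive.ofMul (a i)) →
        (mp.toForm - mq.toForm).eval (fun i => Additive.ofMul (a i)) = Additive.ofMul (f a) ∧
        (mu.toForm - mv.toForm).eval (fun i => Additive.ofMul (a i)) = Additive.ofMul (g a) := by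
      intro a ha
      obtain ⟨⟨h₁, h₂⟩, h₃, h₄⟩ := (hmemL a).1 ha
      simp only [AffineForm.eval_sub, Monom.eval_toForm]
      rw [hpq, huv, cell p mp hσ.1.1 a h₁, cell q mq hσ.1.2 a h₂, cell u mu hσ.2.1 a h₃,
        cell v mv hσ.2.2 a h₄]
      exact ⟨rfl, rfl⟩
    obtain ⟨k, hk⟩ := exists_le_nsmul (A := Additive R) (L := L)
      (fun k hk a => (hdiv k hk a.toMul).imp fun b hb => congrArg Additive.ofMul hb)
      (((hdom _ _).union (hdom _ _)).union ((hdom _ _).union (hdom _ _)))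
      (mp.toForm - mq.toForm) (mu.toForm - mv.toForm) (Additive.ofMul M)
      (fun x hx => by
        have := (hev (fun i => (x i).toMul) hx).2
        simp only [ofMul_toMul] at this
        rw [this]
        exact ⟨hg1 _, hM _⟩)
      (fun x hx hfx => by
        have h₁ := (hev (fun i => (x i).toMul) hx).1
        have h₂ := (hev (fun i => (x i).toMul) hx).2
        simp only [ofMul_toMul] at h₁ h₂
        rw [h₁] at hfx
        rw [h₂]
        exact (h _ (le_antisymm hfx (hf1 _))).le)
    refine ⟨k, fun _ a h₁ h₂ h₃ h₄ => ?_⟩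
    have ha := (hmemL a).2 ⟨⟨fun m hm => h₁ ▸ p.le_eval hm a, fun m hm => h₂ ▸ q.le_eval hm a⟩,
      fun m hm => h₃ ▸ u.le_eval hm a, fun m hm => h₄ ▸ v.le_eval hm a⟩
    have := hk _ ha
    rw [(hev a ha).1, (hev a ha).2] at this
    exact this
  choose k hk using key
  -- The largest exponent serves all cells because `1 ≤ f`.
  refine ⟨((p.monoms ×ˢ q.monoms) ×ˢ u.monoms ×ˢ v.monoms).sup k, fun a => ?_⟩
  obtain ⟨mp, hp, ep⟩ := p.exists_eval_eq a
  obtain ⟨mq, hq, eq⟩ := q.exists_eval_eq a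
  obtain ⟨mu, hu, eu⟩ := u.exists_eval_eq a
  obtain ⟨mv, hv, ev⟩ := v.exists_eval_eq a
  have hσ : ((mp, mq), mu, mv) ∈ (p.monoms ×ˢ q.monoms) ×ˢ u.monoms ×ˢ v.monoms := by
    simp [hp, hq, hu, hv]
  exact (hk _ hσ a ep eq eu ev).trans (pow_le_pow_right' (hf1 a) (Finset.le_sup hσ))

end Fractions

/-! ### Kernels of semifields of functions -/

section Kernels

variable {S : Type*} [CommGroup S] [Lattice S] {U : Subsemifield S}

theorem Subsemifield.mabs_mem {a : S} (ha : a ∈ U.toSubgroup) : |a|ₘ ∈ U.toSubgroup :=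
  U.sup_mem' ha (inv_mem ha)

theorem kernelSpan_le {K : Subgroup S} (hK : IsKernel U K) {A : Set S} (hA : A ⊆ K) :
    kernelSpan U A ≤ K :=
  sInf_le ⟨hK, hA⟩

variable [IsOrderedMonoid S]

theorem Subsemifield.inf_mem {a b : S} (ha : a ∈ U.toSubgroup) (hb : b ∈ U.toSubgroup) :
    a ⊓ b ∈ U.toSubgroup := by
  have h : a ⊓ b = (a⁻¹ ⊔ b⁻¹)⁻¹ := by rw [inv_sup, inv_inv, inv_inv]
  rw [h]
  exact inv_mem (U.sup_mem' (inv_mem ha) (inv_mem hb))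

/-- A kernel is a convex subgroup. -/
theorem IsKernel.mem_of_mabs_le {K : Subgroup S} (hK : IsKernel U K) {f g : S} (hf : f ∈ K)
    (hg : g ∈ U.toSubgroup) (h : |g|ₘ ≤ |f|ₘ) : g ∈ K := by
  have hF : |f|ₘ ∈ K := by
    have h := hK.2 1 (one_mem _) 1 (one_mem _) (sup_idem 1) f hf f⁻¹ (inv_mem hf)
    rwa [one_mul, one_mul] at h
  have hFF := mul_mem hF hF
  have hgF : g * |f|ₘ ∈ U.toSubgroup := mul_mem hg (hK.1 hF)
  -- Put `F = |f|`. The kernel condition with `x = g F / F²`, `y = 1` and the elements `F²`, `1` of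
  -- `K` gives `g F ⊔ 1 ∈ K`. The bounds `1 ≤ g F ≤ F²` make `x ⊔ y = 1` and `g F ⊔ 1 = g F`;
  -- dividing by `F` leaves `g`.
  have h₁ : 1 ≤ g * |f|ₘ := by
    rw [← inv_le_iff_one_le_mul']
    exact (inv_le_mabs g).trans h
  have h₂ : g * |f|ₘ / (|f|ₘ * |f|ₘ) ≤ 1 := by
    rw [div_le_one']
    exact mul_le_mul_left ((le_mabs_self g).trans h) _
  have h₃ := hK.2 _ (div_mem hgF (hK.1 hFF)) 1 (one_mem _) (sup_eq_right.2 h₂) _ hFF 1 (one_mem _)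
  rw [div_mul_cancel, one_mul, sup_eq_left.2 h₁] at h₃
  simpa using div_mem h₃ hF

end Kernels

section Fractions

variable {R : Type*} [CommGroup R] {n : ℕ}

/-- The product of monomials. -/
def Monom.mul (m m' : Monom R n) : Monom R n := (m.1 + m'.1, m.2 * m'.2)

theorem Monom.eval_mul (m m' : Monom R n) (a : Fin n → R) :
    (m.mul m').eval a = m.eval a * m'.eval a := by
  change m.2 * m'.2 * ∏ i, a i ^ (m.1 i + m'.1 i) = _
  simp only [Monom.eval, pow_add, Finset.prod_mul_distrib]
  exact mul_mul_mul_comm _ _ _ _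

theorem Monom.mul_left_cancel {m m₁ m₂ : Monom R n} (h : m.mul m₁ = m.mul m₂) : m₁ = m₂ := by
  have h₁ : m.1 + m₁.1 = m.1 + m₂.1 := congrArg Prod.fst h
  have h₂ : m.2 * m₁.2 = m.2 * m₂.2 := congrArg Prod.snd h
  exact Prod.ext (add_left_cancel h₁) (_root_.mul_left_cancel h₂)

theorem Monom.mul_comm (m m' : Monom R n) : m.mul m' = m'.mul m :=
  Prod.ext (add_comm _ _) (_root_.mul_comm _ _)

variable [LinearOrder R]

/-- The points at which two different monomials of `p` attain the value of `p`. -/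
def TropPoly.corner (p : TropPoly R n) : Set (Fin n → R) :=
  {a | ∃ m ∈ p.monoms, ∃ m' ∈ p.monoms, m ≠ m' ∧ m.eval a = p.eval a ∧ m'.eval a = p.eval a}

open Classical in
/-- The product of polynomials. -/
def TropPoly.mul (p q : TropPoly R n) : TropPoly R n :=
  ⟨(p.monoms ×ˢ q.monoms).image fun x => x.1.mul x.2, (p.nonempty.product q.nonempty).image _⟩

open Classical in
/-- The sum of polynomials. -/
def TropPoly.add (p q : TropPoly R n) : TropPoly R n :=
  ⟨p.monoms ∪ q.monoms, p.nonempty.mono Finset.subset_union_left⟩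

theorem TropPoly.mul_mem_mul {p q : TropPoly R n} {m m' : Monom R n} (hm : m ∈ p.monoms)
    (hm' : m' ∈ q.monoms) : m.mul m' ∈ (p.mul q).monoms :=
  Finset.mem_image.2 ⟨(m, m'), Finset.mem_product.2 ⟨hm, hm'⟩, rfl⟩

theorem TropPoly.mem_add {R : Type*} [LinearOrder R] {n : ℕ} {p q : TropPoly R n} {m : Monom R n} :
    m ∈ (p.add q).monoms ↔ m ∈ p.monoms ∨ m ∈ q.monoms :=
  Finset.mem_union

theorem TropPoly.eval_add (p q : TropPoly R n) (a : Fin n → R) :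
    (p.add q).eval a = p.eval a ⊔ q.eval a :=
  Finset.sup'_union p.nonempty q.nonempty _

theorem isKernel_ker (U : Subsemifield ((Fin n → R) → R)) (Z : Set (Fin n → R)) :
    IsKernel U (Ker U Z) := by
  refine ⟨fun f hf => hf.1, fun x hx y hy hxy f hf g hg => ⟨U.sup_mem' (mul_mem hx hf.1)
    (mul_mem hy hg.1), fun a ha => ?_⟩⟩
  rw [Pi.sup_apply, Pi.mul_apply, Pi.mul_apply, hf.2 a ha, hg.2 a ha, mul_one, mul_one]
  exact congrFun hxy a

theorem skel_ker {U : Subsemifield ((Fin n → R) → R)} {f : (Fin n → R) → R}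
    (hf : f ∈ U.toSubgroup) : Skel (Ker U {a | f a = 1}) = {a | f a = 1} := by
  ext a
  exact ⟨fun h => h f ⟨hf, fun _ hb => hb⟩, fun h g hg => hg.2 a h⟩

theorem ker_union (U : Subsemifield ((Fin n → R) → R)) (Z Z' : Set (Fin n → R)) :
    Ker U (Z ∪ Z') = Ker U Z ⊓ Ker U Z' := by
  ext f
  constructor
  · exact fun h => ⟨⟨h.1, fun a ha => h.2 a (Or.inl ha)⟩, ⟨h.1, fun a ha => h.2 a (Or.inr ha)⟩⟩
  · exact fun h => ⟨h.1.1, fun a ha => ha.elim (h.1.2 a) (h.2.2 a)⟩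

theorem ker_anti (U : Subsemifield ((Fin n → R) → R)) {Z Z' : Set (Fin n → R)} (h : Z ⊆ Z') :
    Ker U Z' ≤ Ker U Z := fun _ hf => ⟨hf.1, fun a ha => hf.2 a (h ha)⟩

variable [IsOrderedMonoid R]

theorem const_mem_ratFun (c : R) : Function.const (Fin n → R) c ∈ (ratFun R n).toSubgroup := by
  obtain ⟨u, hu⟩ := TropPoly.exists_one (R := R) (n := n)
  exact ⟨⟨{(0, c)}, Finset.singleton_nonempty _⟩, u, fun a => by
    rw [hu]
    simp [TropPoly.eval, Monom.eval]⟩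

/-- The bounded fractions. -/
def boundedRatFun (R : Type*) [CommGroup R] [LinearOrder R] [IsOrderedMonoid R] (n : ℕ) :
    Subgroup ((Fin n → R) → R) where
  carrier := {f | f ∈ (ratFun R n).toSubgroup ∧ ∃ c, ∀ a, |f a|ₘ ≤ c}
  one_mem' := ⟨one_mem _, 1, fun a => by simp⟩
  mul_mem' := by
    rintro f g ⟨hf, c, hc⟩ ⟨hg, d, hd⟩
    exact ⟨mul_mem hf hg, c * d, fun a => (mabs_mul_le _ _).trans (mul_le_mul' (hc a) (hd a))⟩
  inv_mem' := by
    rintro f ⟨hf, c, hc⟩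
    exact ⟨inv_mem hf, c, fun a => by simpa using hc a⟩

/-- If `x ⊔ y = 1`, then `x f ⊔ y g` is trapped between the same constants as `f` and `g`. -/
theorem isKernel_boundedRatFun : IsKernel (ratFun R n) (boundedRatFun R n) := by
  refine ⟨fun f hf => hf.1, ?_⟩
  rintro x hx y hy hxy f ⟨hf, c, hc⟩ g ⟨hg, d, hd⟩
  refine ⟨(ratFun R n).sup_mem' (mul_mem hx hf) (mul_mem hy hg), c ⊔ d, fun a => ?_⟩
  have h : x a ⊔ y a = 1 := congrFun hxy a
  have hf' := mabs_le.1 ((hc a).trans (le_max_left c d))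
  have hg' := mabs_le.1 ((hd a).trans (le_max_right c d))
  simp only [Pi.sup_apply, Pi.mul_apply]
  refine mabs_le.2 ⟨?_, ?_⟩
  · calc (c ⊔ d)⁻¹ = (x a ⊔ y a) * (c ⊔ d)⁻¹ := by rw [h, one_mul]
      _ = x a * (c ⊔ d)⁻¹ ⊔ y a * (c ⊔ d)⁻¹ := sup_mul _ _ _
      _ ≤ _ := sup_le_sup (mul_le_mul_right hf'.1 _) (mul_le_mul_right hg'.1 _)
  · calc x a * f a ⊔ y a * g a ≤ x a * (c ⊔ d) ⊔ y a * (c ⊔ d) :=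
          sup_le_sup (mul_le_mul_right hf'.2 _) (mul_le_mul_right hg'.2 _)
      _ = (x a ⊔ y a) * (c ⊔ d) := (sup_mul _ _ _).symm
      _ = c ⊔ d := by rw [h, one_mul]

theorem constKernel_toSubgroup : (constKernel R n).toSubgroup = boundedRatFun R n := by
  refine le_antisymm (kernelSpan_le isKernel_boundedRatFun ?_) ?_
  · rintro _ ⟨c, rfl⟩
    exact ⟨const_mem_ratFun c, |c|ₘ, fun a => le_rfl⟩
  · rintro f ⟨hf, c, hc⟩
    refine Subgroup.mem_sInf.2 fun K hK => hK.1.mem_of_mabs_le (hK.2 ⟨c, rfl⟩) hf fun a => ?_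
    exact (hc a).trans (le_mabs_self c)

theorem mem_constKernel {f : (Fin n → R) → R} :
    f ∈ (constKernel R n).toSubgroup ↔ f ∈ (ratFun R n).toSubgroup ∧ ∃ c, ∀ a, |f a|ₘ ≤ c := by
  rw [constKernel_toSubgroup]
  exact Iff.rfl

/-- The Nullstellensatz in the semifield of bounded fractions. -/
theorem exists_mabs_le_pow [Nontrivial R] [MulArchimedean R]
    (hdiv : ∀ k : ℕ, k ≠ 0 → ∀ a : R, ∃ b : R, b ^ k = a) {f g : (Fin n → R) → R}
    (hf : f ∈ (constKernel R n).toSubgroup) (hg : g ∈ (constKernel R n).toSubgroup)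
    (h : ∀ a, f a = 1 → g a = 1) : ∃ k : ℕ, ∀ a, |g a|ₘ ≤ |f a|ₘ ^ k := by
  obtain ⟨hf, -⟩ := mem_constKernel.1 hf
  obtain ⟨hg, M, hM⟩ := mem_constKernel.1 hg
  exact exists_le_pow_of_eq_one hdiv (Subsemifield.mabs_mem hf) (Subsemifield.mabs_mem hg)
    (fun a => one_le_mabs _) (fun a => one_le_mabs _) hM
    fun a ha => mabs_eq_one.2 (h a (mabs_eq_one.1 ha))

/-- The Nullstellensatz bounds `g` by a power of `f`, and convexity puts it into every kernel
containing `f`. -/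
theorem kernelSpan_singleton [Nontrivial R] [MulArchimedean R]
    (hdiv : ∀ k : ℕ, k ≠ 0 → ∀ a : R, ∃ b : R, b ^ k = a) {f : (Fin n → R) → R}
    (hf : f ∈ (constKernel R n).toSubgroup) :
    kernelSpan (constKernel R n) {f} = Ker (constKernel R n) {a | f a = 1} := by
  refine le_antisymm (kernelSpan_le (isKernel_ker _ _)
    (singleton_subset_iff.2 ⟨hf, fun _ ha => ha⟩)) fun g hg => Subgroup.mem_sInf.2 fun K hK => ?_
  obtain ⟨k, hk⟩ := exists_mabs_le_pow hdiv hf hg.1 hg.2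
  refine hK.1.mem_of_mabs_le (pow_mem (hK.2 rfl) k) hg.1 fun a => ?_
  have := hk a
  rw [← mabs_pow] at this
  exact this

/-! ### Zero sets of fractions -/

variable (R n) in
/-- The sets `{f = 1}` for fractions `f`. -/
def fracLoci : Set (Set (Fin n → R)) :=
  {Z | ∃ f ∈ (ratFun R n).toSubgroup, Z = {a | f a = 1}}

/-- Truncating `|f|` at a constant `c > 1` makes it bounded without changing where it equals `1`.
Hence bounded fractions have the same zero sets as all fractions. -/
theorem exists_constKernel_of_mem_fracLoci [Nontrivial R] {Z : Set (Fin n → R)}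
    (hZ : Z ∈ fracLoci R n) :
    ∃ f ∈ (constKernel R n).toSubgroup, (∀ a, 1 ≤ f a) ∧ Z = {a | f a = 1} := by
  obtain ⟨f, hf, rfl⟩ := hZ
  obtain ⟨c, hc⟩ := exists_one_lt' (α := R)
  have h1 : ∀ a, 1 ≤ (|f|ₘ ⊓ Function.const _ c) a := fun a => le_inf (one_le_mabs (f a)) hc.le
  refine ⟨|f|ₘ ⊓ Function.const _ c, mem_constKernel.2 ⟨Subsemifield.inf_mem
    (Subsemifield.mabs_mem hf) (const_mem_ratFun c), c, fun a => ?_⟩, h1, ?_⟩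
  · rw [mabs_of_one_le (h1 a)]
    exact inf_le_right
  · ext a
    have e : (|f|ₘ ⊓ Function.const _ c) a = |f a|ₘ ⊓ c := rfl
    simp only [mem_ofPred_eq, e]
    rcases le_total |f a|ₘ c with h | h
    · rw [inf_eq_left.2 h, mabs_eq_one]
    · rw [inf_eq_right.2 h]
      refine ⟨fun h' => ?_, fun h' => absurd h' hc.ne'⟩
      rw [h', mabs_one] at h
      exact absurd hc (not_lt.2 h)

theorem fracLoci_of_mem {f : (Fin n → R) → R} (hf : f ∈ (constKernel R n).toSubgroup) :
    {a | f a = 1} ∈ fracLoci R n := ⟨f, (mem_constKernel.1 hf).1, rfl⟩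

theorem fracLoci_inter {Z Z' : Set (Fin n → R)} (hZ : Z ∈ fracLoci R n)
    (hZ' : Z' ∈ fracLoci R n) : Z ∩ Z' ∈ fracLoci R n := by
  obtain ⟨f, hf, rfl⟩ := hZ
  obtain ⟨g, hg, rfl⟩ := hZ'
  refine ⟨|f|ₘ * |g|ₘ, mul_mem (Subsemifield.mabs_mem hf) (Subsemifield.mabs_mem hg), ?_⟩
  ext a
  have e : (|f|ₘ * |g|ₘ) a = |f a|ₘ * |g a|ₘ := rfl
  simp only [mem_inter_iff, mem_ofPred_eq, e,
    mul_eq_one_iff_of_one_le (one_le_mabs (f a)) (one_le_mabs (g a)), mabs_eq_one]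

theorem fracLoci_union {Z Z' : Set (Fin n → R)} (hZ : Z ∈ fracLoci R n)
    (hZ' : Z' ∈ fracLoci R n) : Z ∪ Z' ∈ fracLoci R n := by
  obtain ⟨f, hf, rfl⟩ := hZ
  obtain ⟨g, hg, rfl⟩ := hZ'
  refine ⟨|f|ₘ ⊓ |g|ₘ, Subsemifield.inf_mem (Subsemifield.mabs_mem hf)
    (Subsemifield.mabs_mem hg), ?_⟩
  ext a
  have e : (|f|ₘ ⊓ |g|ₘ) a = |f a|ₘ ⊓ |g a|ₘ := rfl
  have h : |f a|ₘ ⊓ |g a|ₘ = 1 ↔ |f a|ₘ ≤ 1 ∨ |g a|ₘ ≤ 1 := by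
    rw [← inf_le_iff]
    exact ⟨le_of_eq, fun h => le_antisymm h (le_inf (one_le_mabs _) (one_le_mabs _))⟩
  simp only [mem_union, mem_ofPred_eq, e, h, mabs_le_one]

theorem univ_mem_fracLoci : univ ∈ fracLoci R n :=
  ⟨1, one_mem _, by simp⟩

theorem empty_mem_fracLoci [Nontrivial R] : ∅ ∈ fracLoci R n := by
  obtain ⟨c, hc⟩ := exists_ne (1 : R)
  exact ⟨Function.const _ c, const_mem_ratFun c, by simp [hc]⟩

theorem halfspace_mem_fracLoci (m m' : Monom R n) :
    {a | m.eval a ≤ m'.eval a} ∈ fracLoci R n := by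
  have h : (fun a => m.eval a / m'.eval a) ∈ (ratFun R n).toSubgroup :=
    ⟨⟨{m}, Finset.singleton_nonempty _⟩, ⟨{m'}, Finset.singleton_nonempty _⟩, fun a => by
      simp [TropPoly.eval]⟩
  refine ⟨_, (ratFun R n).sup_mem' h (one_mem (ratFun R n).toSubgroup), ?_⟩
  ext a
  simp

theorem iInter_mem_fracLoci {ι : Type*} (s : Finset ι) (Z : ι → Set (Fin n → R))
    (hZ : ∀ i ∈ s, Z i ∈ fracLoci R n) : {a | ∀ i ∈ s, a ∈ Z i} ∈ fracLoci R n := by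
  classical
  induction s using Finset.induction_on with
  | empty => simpa using univ_mem_fracLoci
  | insert i s _ ih =>
    convert fracLoci_inter (hZ i (by simp)) (ih fun j hj => hZ j (by simp [hj])) using 1
    ext a
    simp

theorem iUnion_mem_fracLoci [Nontrivial R] {ι : Type*} (s : Finset ι) (Z : ι → Set (Fin n → R))
    (hZ : ∀ i ∈ s, Z i ∈ fracLoci R n) : {a | ∃ i ∈ s, a ∈ Z i} ∈ fracLoci R n := by
  classical
  induction s using Finset.induction_on with
  | empty => simpa using empty_mem_fracLoci
  | insert i s _ ih =>
    convert fracLoci_union (hZ i (by simp)) (ih fun j hj => hZ j (by simp [hj])) using 1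
    ext a
    simp

theorem skel_ker_of_mem_fracLoci [Nontrivial R] {Z : Set (Fin n → R)} (hZ : Z ∈ fracLoci R n) :
    Skel (Ker (constKernel R n) Z) = Z := by
  obtain ⟨f, hf, -, rfl⟩ := exists_constKernel_of_mem_fracLoci hZ
  exact skel_ker hf

/-- A Riesz decomposition. With `1 ≤ f, f'`, the Nullstellensatz gives `|g| ≤ (f f') ^ k`. Clamping
`g` to `[f ^ (-k), f ^ k]` yields a factor that is `1` where `f = 1`. Where `f' = 1` the clamp does
not alter `g`, so the complementary factor is `1` there. -/
theorem ker_inter [Nontrivial R] [MulArchimedean R]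
    (hdiv : ∀ k : ℕ, k ≠ 0 → ∀ a : R, ∃ b : R, b ^ k = a) {Z Z' : Set (Fin n → R)}
    (hZ : Z ∈ fracLoci R n) (hZ' : Z' ∈ fracLoci R n) :
    Ker (constKernel R n) (Z ∩ Z') = Ker (constKernel R n) Z ⊔ Ker (constKernel R n) Z' := by
  refine le_antisymm (fun g hg => ?_)
    (sup_le (ker_anti _ inter_subset_left) (ker_anti _ inter_subset_right))
  obtain ⟨f, hf, hf1, rfl⟩ := exists_constKernel_of_mem_fracLoci hZ
  obtain ⟨f', hf', hf1', rfl⟩ := exists_constKernel_of_mem_fracLoci hZ'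
  obtain ⟨k, hk⟩ := exists_mabs_le_pow hdiv (mul_mem hf hf') hg.1 fun a ha =>
    hg.2 a ((mul_eq_one_iff_of_one_le (hf1 a) (hf1' a)).1 ha)
  have hclamp : (g ⊓ f ^ k) ⊔ (f ^ k)⁻¹ ∈ (constKernel R n).toSubgroup :=
    (constKernel R n).sup_mem' (Subsemifield.inf_mem hg.1 (pow_mem hf k)) (inv_mem (pow_mem hf k))
  rw [← mul_div_cancel ((g ⊓ f ^ k) ⊔ (f ^ k)⁻¹) g]
  refine Subgroup.mul_mem_sup ⟨hclamp, fun a ha => ?_⟩ ⟨div_mem hg.1 hclamp, fun a ha => ?_⟩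
  · have ha : f a = 1 := ha
    simp [ha]
  · have ha : f' a = 1 := ha
    have h := hk a
    rw [Pi.mul_apply, ha, mul_one, mabs_of_one_le (hf1 a), mabs_le] at h
    simp [inf_eq_left.2 h.2, h.1]

/-- Every lattice of zero sets corresponds to the kernels of its members. -/
theorem isLatticeCorrespondence_of_subset_fracLoci [Nontrivial R] [MulArchimedean R]
    (hdiv : ∀ k : ℕ, k ≠ 0 → ∀ a : R, ∃ b : R, b ^ k = a) {L : Set (Set (Fin n → R))}
    (hL : L ⊆ fracLoci R n) (hinter : ∀ Z ∈ L, ∀ Z' ∈ L, Z ∩ Z' ∈ L)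
    (hunion : ∀ Z ∈ L, ∀ Z' ∈ L, Z ∪ Z' ∈ L) :
    IsLatticeCorrespondence Skel (Ker (constKernel R n) '' L) L where
  mul_mem := by
    rintro _ ⟨Z, hZ, rfl⟩ _ ⟨Z', hZ', rfl⟩
    exact ⟨_, hinter Z hZ Z' hZ', ker_inter hdiv (hL hZ) (hL hZ')⟩
  inter_mem := by
    rintro _ ⟨Z, hZ, rfl⟩ _ ⟨Z', hZ', rfl⟩
    exact ⟨_, hunion Z hZ Z' hZ', ker_union _ _ _⟩
  locus_inter_mem := hinter
  locus_union_mem := hunion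
  bijOn := by
    refine ⟨?_, ?_, fun Z hZ => ⟨_, ⟨Z, hZ, rfl⟩, skel_ker_of_mem_fracLoci (hL hZ)⟩⟩
    · rintro _ ⟨Z, hZ, rfl⟩
      rwa [skel_ker_of_mem_fracLoci (hL hZ)]
    · rintro _ ⟨Z, hZ, rfl⟩ _ ⟨Z', hZ', rfl⟩ h
      rw [skel_ker_of_mem_fracLoci (hL hZ), skel_ker_of_mem_fracLoci (hL hZ')] at h
      rw [h]
  map_mul := by
    rintro _ ⟨Z, hZ, rfl⟩ _ ⟨Z', hZ', rfl⟩
    rw [← ker_inter hdiv (hL hZ) (hL hZ'), skel_ker_of_mem_fracLoci (hL hZ),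
      skel_ker_of_mem_fracLoci (hL hZ'), skel_ker_of_mem_fracLoci (hL (hinter Z hZ Z' hZ'))]
  map_inter := by
    rintro _ ⟨Z, hZ, rfl⟩ _ ⟨Z', hZ', rfl⟩
    rw [← ker_union, skel_ker_of_mem_fracLoci (hL hZ),
      skel_ker_of_mem_fracLoci (hL hZ'), skel_ker_of_mem_fracLoci (hL (hunion Z hZ Z' hZ'))]
  le_iff := by
    rintro _ ⟨Z, hZ, rfl⟩ _ ⟨Z', hZ', rfl⟩
    refine ⟨fun h a ha f hf => ha f (h hf), fun h => ker_anti _ ?_⟩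
    rwa [skel_ker_of_mem_fracLoci (hL hZ), skel_ker_of_mem_fracLoci (hL hZ')] at h

theorem pCon_constKernel [Nontrivial R] [MulArchimedean R]
    (hdiv : ∀ k : ℕ, k ≠ 0 → ∀ a : R, ∃ b : R, b ^ k = a) :
    PCon (constKernel R n) = Ker (constKernel R n) '' fracLoci R n := by
  ext K
  constructor
  · rintro ⟨f, hf, rfl⟩
    exact ⟨_, fracLoci_of_mem hf, (kernelSpan_singleton hdiv hf).symm⟩
  · rintro ⟨Z, hZ, rfl⟩
    obtain ⟨f, hf, -, rfl⟩ := exists_constKernel_of_mem_fracLoci hZ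
    exact ⟨f, hf, (kernelSpan_singleton hdiv hf).symm⟩

/-! ### Corners of polynomials, regular fractions -/

theorem TropPoly.eval_mul (p q : TropPoly R n) (a : Fin n → R) :
    (p.mul q).eval a = p.eval a * q.eval a := by
  refine le_antisymm ((p.mul q).eval_le_iff.2 fun m hm => ?_) ?_
  · obtain ⟨⟨m₁, m₂⟩, hx, rfl⟩ := Finset.mem_image.1 hm
    rw [Finset.mem_product] at hx
    rw [Monom.eval_mul]
    exact mul_le_mul' (p.le_eval hx.1 a) (q.le_eval hx.2 a)
  · obtain ⟨m₁, h₁, e₁⟩ := p.exists_eval_eq a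
    obtain ⟨m₂, h₂, e₂⟩ := q.exists_eval_eq a
    rw [e₁, e₂, ← Monom.eval_mul]
    exact (p.mul q).le_eval (mul_mem_mul h₁ h₂) a

/-- Two tied monomials of `p` stay tied, and by cancellation distinct, after multiplication by a
dominating monomial of `q`. -/
theorem TropPoly.corner_subset_corner_mul_left (p q : TropPoly R n) :
    p.corner ⊆ (p.mul q).corner := by
  rintro a ⟨m, hm, m', hm', hne, e, e'⟩
  obtain ⟨k, hk, ek⟩ := q.exists_eval_eq a
  refine ⟨m.mul k, mul_mem_mul hm hk, m'.mul k, mul_mem_mul hm' hk, fun h => hne ?_, ?_, ?_⟩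
  · rw [m.mul_comm, m'.mul_comm] at h
    exact Monom.mul_left_cancel h
  · rw [Monom.eval_mul, TropPoly.eval_mul, e, ek]
  · rw [Monom.eval_mul, TropPoly.eval_mul, e', ek]

theorem TropPoly.corner_subset_corner_mul_right (p q : TropPoly R n) :
    q.corner ⊆ (p.mul q).corner := by
  have h : p.mul q = q.mul p := by
    simp only [TropPoly.mul, TropPoly.mk.injEq]
    ext m
    simp only [Finset.mem_image, Finset.mem_product]
    constructor <;> rintro ⟨x, h, rfl⟩ <;> exact ⟨x.swap, h.symm, Monom.mul_comm _ _⟩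
  rw [h]
  exact q.corner_subset_corner_mul_left p

/-- A fraction is regular if and only if the set where it is `1` consists of corners of some
polynomial. -/
theorem isRegular_iff {f : (Fin n → R) → R} (hf : f ∈ (ratFun R n).toSubgroup) :
    IsRegular f ↔ ∃ p : TropPoly R n, {a | f a = 1} ⊆ p.corner := by
  constructor
  · rintro ⟨h, g, hfrac, hreg⟩
    -- Where `f = 1`, `h` and `g` agree, so the two monomials supplied by regularity tie in `h + g`.
    refine ⟨h.add g, fun a ha => ?_⟩
    obtain ⟨m, hm, m', hm', e, e', hne⟩ := hreg a
    have hhg : h.eval a = g.eval a := by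
      rw [← div_eq_one, ← hfrac]
      exact ha
    refine ⟨m, TropPoly.mem_add.2 (Or.inl hm), m', TropPoly.mem_add.2 (Or.inr hm'), hne, ?_, ?_⟩
    · rw [TropPoly.eval_add, ← hhg, sup_idem, e]
    · rw [TropPoly.eval_add, hhg, sup_idem, e']
  · rintro ⟨p, hp⟩
    obtain ⟨h, g, hfrac⟩ := hf
    -- Expanding the fraction by `p` makes it regular. Where `f ≠ 1`, dominating monomials of `h p`
    -- and `g p` differ in value. Where `f = 1`, `p` offers two dominating monomials `k ≠ k'`, and
    -- if `m k = m' k` then `m k ≠ m' k'`.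
    refine ⟨h.mul p, g.mul p, fun a => ?_, fun a => ?_⟩
    · rw [hfrac, TropPoly.eval_mul, TropPoly.eval_mul, mul_div_mul_right_eq_div]
    · obtain ⟨m, hm, e⟩ := h.exists_eval_eq a
      obtain ⟨m', hm', e'⟩ := g.exists_eval_eq a
      by_cases ha : f a = 1
      · obtain ⟨k, hk, k', hk', hne, ek, ek'⟩ := hp ha
        by_cases heq : m.mul k = m'.mul k
        · refine ⟨m.mul k, TropPoly.mul_mem_mul hm hk, m'.mul k', TropPoly.mul_mem_mul hm' hk',
            ?_, ?_, fun h => hne (Monom.mul_left_cancel (heq.symm.trans h))⟩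
          · rw [Monom.eval_mul, TropPoly.eval_mul, e, ek]
          · rw [Monom.eval_mul, TropPoly.eval_mul, e', ek']
        · refine ⟨m.mul k, TropPoly.mul_mem_mul hm hk, m'.mul k, TropPoly.mul_mem_mul hm' hk,
            ?_, ?_, heq⟩
          · rw [Monom.eval_mul, TropPoly.eval_mul, e, ek]
          · rw [Monom.eval_mul, TropPoly.eval_mul, e', ek]
      · obtain ⟨k, hk, ek⟩ := p.exists_eval_eq a
        refine ⟨m.mul k, TropPoly.mul_mem_mul hm hk, m'.mul k, TropPoly.mul_mem_mul hm' hk,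
          ?_, ?_, fun h => ha ?_⟩
        · rw [Monom.eval_mul, TropPoly.eval_mul, e, ek]
        · rw [Monom.eval_mul, TropPoly.eval_mul, e', ek]
        · have := congrArg (fun m : Monom R n => m.eval a) h
          simp only [Monom.eval_mul] at this
          rw [hfrac, e, e', mul_right_cancel this, div_self']

variable (R n) in
/-- The zero sets of fractions that consist of corners of some polynomial. -/
def thinLoci : Set (Set (Fin n → R)) :=
  {Z | Z ∈ fracLoci R n ∧ ∃ p : TropPoly R n, Z ⊆ p.corner}

theorem thinLoci_inter {Z Z' : Set (Fin n → R)} (hZ : Z ∈ thinLoci R n)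
    (hZ' : Z' ∈ thinLoci R n) : Z ∩ Z' ∈ thinLoci R n :=
  ⟨fracLoci_inter hZ.1 hZ'.1, hZ.2.imp fun _ h => inter_subset_left.trans h⟩

theorem thinLoci_union {Z Z' : Set (Fin n → R)} (hZ : Z ∈ thinLoci R n)
    (hZ' : Z' ∈ thinLoci R n) : Z ∪ Z' ∈ thinLoci R n := by
  obtain ⟨hZ, p, hp⟩ := hZ
  obtain ⟨hZ', q, hq⟩ := hZ'
  exact ⟨fracLoci_union hZ hZ', p.mul q, union_subset
    (hp.trans (p.corner_subset_corner_mul_left q)) (hq.trans (p.corner_subset_corner_mul_right q))⟩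

theorem regPCon_constKernel [Nontrivial R] [MulArchimedean R]
    (hdiv : ∀ k : ℕ, k ≠ 0 → ∀ a : R, ∃ b : R, b ^ k = a) :
    RegPCon (constKernel R n) = Ker (constKernel R n) '' thinLoci R n := by
  ext K
  constructor
  · rintro ⟨f, hf, hreg, rfl⟩
    exact ⟨_, ⟨fracLoci_of_mem hf, (isRegular_iff (mem_constKernel.1 hf).1).1 hreg⟩,
      (kernelSpan_singleton hdiv hf).symm⟩
  · rintro ⟨Z, ⟨hZ, hp⟩, rfl⟩
    obtain ⟨f, hf, -, rfl⟩ := exists_constKernel_of_mem_fracLoci hZ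
    exact ⟨f, hf, (isRegular_iff (mem_constKernel.1 hf).1).2 hp,
      (kernelSpan_singleton hdiv hf).symm⟩

end Fractions

/-! ### Sums in the supertropical semiring -/

namespace Supertropical

section Order

variable {R : Type*}

/-- The value of a nonzero element is less than `c`. -/
def Below [LT R] (c : R) : Supertropical R → Prop
  | zero => True
  | tangible a => a < c
  | ghost a => a < c

/-- The value of a nonzero element. -/
def value [One R] : Supertropical R → R
  | zero => 1
  | tangible a => a
  | ghost a => a

theorem below_zero [LT R] (c : R) : (0 : Supertropical R).Below c := trivial

theorem isGhost_iff {x : Supertropical R} : x.IsGhost ↔ x ≠ 0 ∧ ¬ x.IsTangible := by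
  rcases x with _ | a | a
  · exact ⟨fun h => (nomatch h), fun h => absurd rfl h.1⟩
  · exact ⟨fun h => (nomatch h), fun h => absurd ⟨a, rfl⟩ h.2⟩
  · exact ⟨fun _ => ⟨(nomatch ·), fun h => (nomatch h)⟩, fun _ => ⟨a, rfl⟩⟩

theorem tangible_ne_zero (a : R) : (tangible a : Supertropical R) ≠ 0 := fun h => by cases h

variable [LinearOrder R]

protected theorem add_eq_zero {x y : Supertropical R} : x + y = 0 ↔ x = 0 ∧ y = 0 := by
  change add x y = zero ↔ x = zero ∧ y = zero
  rcases x with _ | a | a <;> rcases y with _ | b | b <;> grind [add]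

theorem add_below {x y : Supertropical R} {c : R} :
    (x + y).Below c ↔ x.Below c ∧ y.Below c := by
  change (add x y).Below c ↔ _
  rcases x with _ | a | a <;> rcases y with _ | b | b <;> grind [add, Below]

theorem add_eq_tangible {x y : Supertropical R} {c : R} :
    x + y = tangible c ↔ (x = tangible c ∧ y.Below c) ∨ (y = tangible c ∧ x.Below c) := by
  change add x y = tangible c ↔ _
  rcases x with _ | a | a <;> rcases y with _ | b | b <;> grind [add, Below]

theorem tangible_add_ghost {b c : R} :
    (tangible b + ghost c : Supertropical R).IsGhost ↔ b ≤ c := by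
  rw [isGhost_iff]
  constructor
  · rintro ⟨-, h⟩
    by_contra! hlt
    exact h ⟨b, add_eq_tangible.2 (Or.inl ⟨rfl, hlt⟩)⟩
  · refine fun h => ⟨fun h0 => tangible_ne_zero b (Supertropical.add_eq_zero.1 h0).1, ?_⟩
    rintro ⟨d, hd⟩
    rcases add_eq_tangible.1 hd with ⟨h₁, h₂⟩ | ⟨h₁, -⟩
    · cases h₁
      exact absurd h₂ (not_lt.2 h)
    · cases h₁

variable [CommGroup R] [IsOrderedMonoid R] {ι : Type*} {s : Finset ι} {x : ι → Supertropical R}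

theorem sum_eq_zero : ∑ i ∈ s, x i = 0 ↔ ∀ i ∈ s, x i = 0 := by
  classical
  induction s using Finset.induction_on with
  | empty => simp
  | insert i s hi ih => rw [Finset.sum_insert hi, Supertropical.add_eq_zero, ih, Finset.forall_mem_insert]

theorem sum_below {c : R} : (∑ i ∈ s, x i).Below c ↔ ∀ i ∈ s, (x i).Below c := by
  classical
  induction s using Finset.induction_on with
  | empty => simpa using below_zero c
  | insert i s hi ih => rw [Finset.sum_insert hi, add_below, ih, Finset.forall_mem_insert]

theorem sum_eq_tangible {c : R} : ∑ i ∈ s, x i = tangible c ↔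
    ∃ i ∈ s, x i = tangible c ∧ ∀ j ∈ s, j ≠ i → (x j).Below c := by
  classical
  have key : ∀ i ∈ s, ∑ j ∈ s, x j = x i + ∑ j ∈ s.erase i, x j := fun i hi =>
    (Finset.add_sum_erase s x hi).symm
  constructor
  · intro h
    induction s using Finset.induction_on with
    | empty => exact absurd h.symm (tangible_ne_zero c)
    | insert i s hi ih =>
      rw [Finset.sum_insert hi] at h
      rcases add_eq_tangible.1 h with ⟨h₁, h₂⟩ | ⟨h₁, h₂⟩
      · refine ⟨i, by simp, h₁, fun j hj hji => ?_⟩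
        exact sum_below.1 h₂ j (Finset.mem_of_mem_insert_of_ne hj hji)
      · obtain ⟨k, hk, e, hb⟩ := ih (fun i hi => (Finset.add_sum_erase s x hi).symm) h₁
        refine ⟨k, by simp [hk], e, fun j hj hjk => ?_⟩
        rcases Finset.mem_insert.1 hj with rfl | hj
        · exact h₂
        · exact hb j hj hjk
  · rintro ⟨i, hi, e, hb⟩
    rw [key i hi]
    exact add_eq_tangible.2 (Or.inl ⟨e, sum_below.2 fun j hj =>
      hb j (Finset.mem_of_mem_erase hj) (Finset.ne_of_mem_erase hj)⟩)

/-- A nonzero sum fails to be a ghost only if it is tangible, that is, if one tangible term strictly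
dominates all the others. -/
theorem isGhost_sum : (∑ i ∈ s, x i).IsGhost ↔ (∃ i ∈ s, x i ≠ 0) ∧
    ∀ i ∈ s, ∀ c, x i = tangible c → ∃ j ∈ s, j ≠ i ∧ ¬ (x j).Below c := by
  rw [isGhost_iff, ne_eq, sum_eq_zero]
  refine and_congr (by push Not; rfl) ?_
  simp only [IsTangible, sum_eq_tangible]
  push Not
  exact ⟨fun h i hi c => h c i hi, fun h c i hi => h i hi c⟩

theorem sum_ghost (hs : s.Nonempty) (u : ι → R) :
    ∑ i ∈ s, (ghost (u i) : Supertropical R) = ghost (s.sup' hs u) := by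
  induction hs using Finset.Nonempty.cons_induction with
  | singleton i => simp
  | cons i s hi hs ih =>
    rw [Finset.sum_cons, ih, Finset.sup'_cons hs]
    rfl

/-- The inclusion of the tangible elements. -/
def tangibleHom (R : Type*) [CommGroup R] [LinearOrder R] [IsOrderedMonoid R] :
    R →* Supertropical R where
  toFun := tangible
  map_one' := rfl
  map_mul' _ _ := rfl

theorem prod_tangible_pow {n : ℕ} (a : Fin n → R) (k : Fin n → ℕ) :
    ∏ i, (tangible (a i) : Supertropical R) ^ k i = tangible (∏ i, a i ^ k i) := by
  have h : ∀ c : R, (tangible c : Supertropical R) = tangibleHom R c := fun _ => rfl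
  simp only [h, ← map_pow, ← map_prod]

end Order

end Supertropical

/-! ### Corner loci and zero sets -/

section CornerLoci

open Supertropical

variable {R : Type*} [CommGroup R] [LinearOrder R] [IsOrderedMonoid R] {n : ℕ}

/-- The monomial of exponent `k` of a supertropical polynomial, with its ghost part forgotten. -/
def monomOf (F : MvPolynomial (Fin n) (Supertropical R)) (k : Fin n →₀ ℕ) : Monom R n :=
  (k, (F.coeff k).value)

theorem isCornerRoot_iff {F : MvPolynomial (Fin n) (Supertropical R)} (hF : F ≠ 0)
    {a : Fin n → R} : IsCornerRoot F a ↔ ∀ k ∈ F.support, (F.coeff k).IsTangible →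
      ∃ l ∈ F.support, l ≠ k ∧ (monomOf F k).eval a ≤ (monomOf F l).eval a := by
  have hmul : ∀ (x : Supertropical R) (c d : R), x ≠ 0 →
      ((x * tangible c).Below d ↔ x.value * c < d) ∧ x * tangible c ≠ 0 := by
    rintro (_ | x | x) c d hx
    · exact absurd rfl hx
    · exact ⟨Iff.rfl, fun h => by cases h⟩
    · exact ⟨Iff.rfl, fun h => by cases h⟩
  rw [IsCornerRoot, MvPolynomial.eval_eq']
  simp only [prod_tangible_pow]
  rw [isGhost_sum]
  constructor
  · rintro ⟨-, h⟩ k hk ⟨c, hc⟩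
    obtain ⟨l, hl, hne, hb⟩ := h k hk (c * ∏ i, a i ^ k i) (by rw [hc]; rfl)
    rw [(hmul _ _ _ (MvPolynomial.mem_support_iff.1 hl)).1, not_lt] at hb
    refine ⟨l, hl, hne, ?_⟩
    simp only [monomOf, Monom.eval, hc]
    exact hb
  · refine fun h => ⟨?_, fun k hk d hd => ?_⟩
    · obtain ⟨k, hk⟩ := MvPolynomial.support_nonempty.2 hF
      exact ⟨k, hk, (hmul _ _ 1 (MvPolynomial.mem_support_iff.1 hk)).2⟩
    · rcases hc : F.coeff k with _ | c | c
      · exact absurd hc (MvPolynomial.mem_support_iff.1 hk)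
      · rw [hc] at hd
        have hd : tangible (c * ∏ i, a i ^ k i) = tangible d := hd
        obtain ⟨l, hl, hne, hle⟩ := h k hk ⟨c, hc⟩
        refine ⟨l, hl, hne, ?_⟩
        rw [(hmul _ _ _ (MvPolynomial.mem_support_iff.1 hl)).1, not_lt]
        simp only [monomOf, Monom.eval, hc] at hle
        injection hd with hd
        rw [← hd]
        exact hle
      · rw [hc] at hd
        cases hd

/-- By `isCornerRoot_iff` the set is a finite intersection, over the tangible monomials, of finite
unions of half-spaces. -/
theorem isCornerRoot_mem_fracLoci [Nontrivial R] {F : MvPolynomial (Fin n) (Supertropical R)}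
    (hF : F ≠ 0) : {a | IsCornerRoot F a} ∈ fracLoci R n := by
  classical
  simp only [isCornerRoot_iff hF]
  refine iInter_mem_fracLoci F.support (fun k => {a | (F.coeff k).IsTangible →
    ∃ l ∈ F.support, l ≠ k ∧ (monomOf F k).eval a ≤ (monomOf F l).eval a}) fun k hk => ?_
  by_cases ht : (F.coeff k).IsTangible
  · convert iUnion_mem_fracLoci (F.support.erase k)
      (fun l => {a | (monomOf F k).eval a ≤ (monomOf F l).eval a})
      fun l _ => halfspace_mem_fracLoci _ _ using 1
    ext a
    simp only [ht, true_imp_iff, mem_ofPred_eq, Finset.mem_erase]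
    exact exists_congr fun l => by tauto
  · simpa [ht] using univ_mem_fracLoci

theorem exists_corner_of_isTangiblePoly {F : MvPolynomial (Fin n) (Supertropical R)} (hF : F ≠ 0)
    (ht : IsTangiblePoly F) : ∃ p : TropPoly R n, {a | IsCornerRoot F a} ⊆ p.corner := by
  classical
  -- A dominating monomial of `F` is tangible, so at a corner root another one ties with it; the two
  -- have different exponents.
  refine ⟨⟨F.support.image (monomOf F), (MvPolynomial.support_nonempty.2 hF).image _⟩,
    fun a ha => ?_⟩
  have ha := (isCornerRoot_iff hF).1 ha
  set p : TropPoly R n := ⟨F.support.image (monomOf F), _⟩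
  obtain ⟨m, hm, e⟩ := p.exists_eval_eq a
  obtain ⟨k, hk, rfl⟩ := Finset.mem_image.1 hm
  obtain ⟨l, hl, hne, hle⟩ := ha k hk (ht k hk)
  have hl' : monomOf F l ∈ p.monoms := Finset.mem_image_of_mem _ hl
  refine ⟨_, hm, _, hl', fun h => hne ?_, e.symm, le_antisymm (p.le_eval hl' a) (e ▸ hle)⟩
  exact DFunLike.coe_injective (congrArg Prod.fst h).symm

/-- A monomial as a supertropical polynomial with coefficient `ν (m.2)`, if `ν` is `ghost`, or
`m.2`, if `ν` is `tangible`. -/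
noncomputable def Monom.toMv (ν : R → Supertropical R) (m : Monom R n) :
    MvPolynomial (Fin n) (Supertropical R) :=
  MvPolynomial.monomial (Finsupp.equivFunOnFinite.symm m.1) (ν m.2)

theorem Monom.eval_toMv (ν : R → Supertropical R)
    (hν : ∀ c d, ν c * tangible d = ν (c * d)) (m : Monom R n) (a : Fin n → R) :
    MvPolynomial.eval (fun i => tangible (a i)) (m.toMv ν) = ν (m.eval a) := by
  rw [Monom.toMv, MvPolynomial.eval_monomial, Finsupp.prod_fintype _ _ fun i => pow_zero _]
  simp only [Finsupp.equivFunOnFinite_symm_apply_apply, prod_tangible_pow, hν]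
  rfl

/-- A polynomial as a tangible supertropical polynomial. -/
noncomputable def TropPoly.toMv (p : TropPoly R n) : MvPolynomial (Fin n) (Supertropical R) :=
  ∑ m ∈ p.monoms, m.toMv tangible

theorem TropPoly.eval_toMv (p : TropPoly R n) (a : Fin n → R) :
    MvPolynomial.eval (fun i => tangible (a i)) p.toMv = ∑ m ∈ p.monoms, tangible (m.eval a) := by
  rw [TropPoly.toMv, map_sum]
  exact Finset.sum_congr rfl fun m _ => m.eval_toMv _ (fun _ _ => rfl) a

theorem TropPoly.toMv_ne_zero (p : TropPoly R n) : p.toMv ≠ 0 := by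
  intro h
  have h0 := p.eval_toMv 1
  rw [h, map_zero, eq_comm, sum_eq_zero] at h0
  obtain ⟨m, hm⟩ := p.nonempty
  exact tangible_ne_zero _ (h0 m hm)

theorem TropPoly.isCornerRoot_toMv (p : TropPoly R n) (a : Fin n → R) :
    IsCornerRoot p.toMv a ↔ a ∈ p.corner := by
  rw [IsCornerRoot, TropPoly.eval_toMv, isGhost_sum]
  constructor
  · rintro ⟨-, h⟩
    obtain ⟨m, hm, e⟩ := p.exists_eval_eq a
    obtain ⟨m', hm', hne, hb⟩ := h m hm _ rfl
    exact ⟨m, hm, m', hm', hne.symm, e.symm,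
      le_antisymm (p.le_eval hm' a) (e ▸ not_lt.1 hb)⟩
  · rintro ⟨m, hm, m', hm', hne, e, e'⟩
    refine ⟨⟨m, hm, tangible_ne_zero _⟩, fun k hk c hc => ?_⟩
    injection hc with hc
    subst hc
    rcases eq_or_ne m k with rfl | hmk
    · exact ⟨m', hm', hne.symm, not_lt.2 (by rw [e']; exact p.le_eval hk a)⟩
    · exact ⟨m, hm, hmk, not_lt.2 (by rw [e]; exact p.le_eval hk a)⟩

/-- Monomials of `p` with a common exponent merge into one coefficient. Being distinct, they have
distinct constants, so the largest is attained once and the sum is tangible. -/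
theorem TropPoly.isTangiblePoly_toMv (p : TropPoly R n) : IsTangiblePoly p.toMv := by
  classical
  intro k hk
  have hcoeff : p.toMv.coeff k = ∑ m ∈ p.monoms with Finsupp.equivFunOnFinite.symm m.1 = k,
      (tangible m.2 : Supertropical R) := by
    rw [TropPoly.toMv, MvPolynomial.coeff_sum, Finset.sum_filter]
    exact Finset.sum_congr rfl fun m _ => by rw [Monom.toMv, MvPolynomial.coeff_monomial]
  have hne : (p.monoms.filter fun m => Finsupp.equivFunOnFinite.symm m.1 = k).Nonempty := by
    rw [Finset.nonempty_iff_ne_empty]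
    intro h
    rw [h, Finset.sum_empty] at hcoeff
    exact MvPolynomial.mem_support_iff.1 hk hcoeff
  obtain ⟨m, hm, hmax⟩ := Finset.exists_max_image _ (fun m : Monom R n => m.2) hne
  refine ⟨m.2, ?_⟩
  rw [hcoeff, sum_eq_tangible]
  refine ⟨m, hm, rfl, fun m' hm' hne => lt_of_le_of_ne (hmax m' hm') fun h => hne ?_⟩
  refine Prod.ext (Finsupp.equivFunOnFinite.symm.injective ?_) h
  rw [(Finset.mem_filter.1 hm').2, (Finset.mem_filter.1 hm).2]

/-- The supertropical polynomial whose corner roots are the points at which `m ≤ g`. -/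
noncomputable def halfspacePoly (g : TropPoly R n) (m : Monom R n) : MvPolynomial (Fin n) (Supertropical R) :=
  m.toMv tangible + ∑ m' ∈ g.monoms, m'.toMv ghost

theorem eval_halfspacePoly (g : TropPoly R n) (m : Monom R n) (a : Fin n → R) :
    MvPolynomial.eval (fun i => tangible (a i)) (halfspacePoly g m) =
      tangible (m.eval a) + ghost (g.eval a) := by
  rw [halfspacePoly, map_add, map_sum, m.eval_toMv _ fun _ _ => rfl, TropPoly.eval,
    ← sum_ghost g.nonempty]
  congr 1
  exact Finset.sum_congr rfl fun m' _ => m'.eval_toMv _ (fun _ _ => rfl) a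

theorem halfspacePoly_ne_zero (g : TropPoly R n) (m : Monom R n) : halfspacePoly g m ≠ 0 := by
  intro h
  have h0 := eval_halfspacePoly g m 1
  rw [h, map_zero, eq_comm, Supertropical.add_eq_zero] at h0
  exact tangible_ne_zero _ h0.1

theorem isCornerRoot_halfspacePoly (g : TropPoly R n) (m : Monom R n) (a : Fin n → R) :
    IsCornerRoot (halfspacePoly g m) a ↔ m.eval a ≤ g.eval a := by
  rw [IsCornerRoot, eval_halfspacePoly, tangible_add_ghost]

theorem cor_mem_fracLoci [Nontrivial R] {S : Set (MvPolynomial (Fin n) (Supertropical R))}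
    (hS : S.Finite) (h0 : ∀ F ∈ S, F ≠ 0) : Cor S ∈ fracLoci R n := by
  convert iInter_mem_fracLoci hS.toFinset (fun F => {a | IsCornerRoot F a})
    fun F hF => isCornerRoot_mem_fracLoci (h0 F (hS.mem_toFinset.1 hF)) using 1
  ext a
  simp [Cor]

variable (R n) in
-- For the inclusion of `fracLoci`, split `h = g` into the conditions `m ≤ g` for `m` in `h` and `m
-- ≤ h` for `m` in `g`, each of which is the corner locus of a `halfspacePoly`.
theorem fcl_eq_fracLoci [Nontrivial R] : FCL R n = fracLoci R n := by
  ext Z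
  constructor
  · rintro ⟨S, hS, -, h0, rfl⟩
    exact cor_mem_fracLoci hS h0
  · rintro ⟨f, ⟨h, g, hfrac⟩, rfl⟩
    refine ⟨halfspacePoly g '' h.monoms ∪ halfspacePoly h '' g.monoms,
      (h.monoms.finite_toSet.image _).union (g.monoms.finite_toSet.image _),
      (Set.Nonempty.image _ h.nonempty).inl, ?_, ?_⟩
    · rintro _ (⟨m, -, rfl⟩ | ⟨m, -, rfl⟩) <;> exact halfspacePoly_ne_zero _ _
    · ext a
      have e : a ∈ Cor (halfspacePoly g '' h.monoms ∪ halfspacePoly h '' g.monoms) ↔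
          h.eval a ≤ g.eval a ∧ g.eval a ≤ h.eval a := by
        rw [h.eval_le_iff, g.eval_le_iff]
        simp only [Cor, mem_ofPred_eq, mem_union, or_imp, forall_and, forall_mem_image,
          isCornerRoot_halfspacePoly]
        exact Iff.rfl
      rw [e, ← le_antisymm_iff, mem_ofPred_eq, hfrac, div_eq_one]

/-- On the corners of `p`, the half-space `m ≤ g` is cut out by corners. -/
theorem TropPoly.forall_mem_corner_iff (p g : TropPoly R n) (m : Monom R n) {a : Fin n → R}
    (ha : a ∈ p.corner) :
    (∀ k ∈ p.monoms, a ∈ ((p.mul g).add ⟨{k.mul m}, Finset.singleton_nonempty _⟩).corner) ↔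
      m.eval a ≤ g.eval a := by
  have hev : ∀ k : Monom R n,
      ((p.mul g).add ⟨{k.mul m}, Finset.singleton_nonempty _⟩).eval a =
        p.eval a * g.eval a ⊔ k.eval a * m.eval a := fun k => by
    rw [TropPoly.eval_add, TropPoly.eval_mul]
    simp [TropPoly.eval, Monom.eval_mul]
  constructor
  -- If `m > g` at `a`, let `k` dominate `p`: then `k m` strictly exceeds every monomial of `p g`,
  -- so nothing ties with it.
  · intro h
    by_contra! hlt
    obtain ⟨k, hk, ek⟩ := p.exists_eval_eq a
    have hlt' : p.eval a * g.eval a < k.eval a * m.eval a := ek ▸ mul_lt_mul_right hlt _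
    obtain ⟨u, hu, v, hv, hne, eu, ev⟩ := h k hk
    rw [hev, sup_eq_right.2 hlt'.le] at eu ev
    have huniq : ∀ w ∈ ((p.mul g).add ⟨{k.mul m}, Finset.singleton_nonempty _⟩).monoms,
        w.eval a = k.eval a * m.eval a → w = k.mul m := by
      intro w hw e
      rcases TropPoly.mem_add.1 hw with hw | hw
      · have := (p.mul g).le_eval hw a
        rw [e, TropPoly.eval_mul] at this
        exact absurd hlt' (not_lt.2 this)
      · exact Finset.mem_singleton.1 hw
    exact hne ((huniq u hu eu).trans (huniq v hv ev).symm)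
  -- If `m ≤ g`, then `k m` does not raise the value of `p g`, whose ties, inherited from `p`,
  -- persist.
  · intro hle k hk
    obtain ⟨u, hu, v, hv, hne, eu, ev⟩ := p.corner_subset_corner_mul_left g ha
    have e : ((p.mul g).add ⟨{k.mul m}, Finset.singleton_nonempty _⟩).eval a = (p.mul g).eval a := by
      rw [hev, TropPoly.eval_mul, sup_eq_left.2 (mul_le_mul' (p.le_eval hk a) hle)]
    exact ⟨u, TropPoly.mem_add.2 (Or.inl hu), v, TropPoly.mem_add.2 (Or.inl hv), hne,
      e ▸ eu, e ▸ ev⟩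

variable (R n) in
theorem frcl_eq_thinLoci [Nontrivial R] : FRCL R n = thinLoci R n := by
  classical
  ext Z
  constructor
  · rintro ⟨S, hS, ⟨F, hF⟩, h0, rfl⟩
    refine ⟨cor_mem_fracLoci hS fun F hF => (h0 F hF).1, ?_⟩
    obtain ⟨p, hp⟩ := exists_corner_of_isTangiblePoly (h0 F hF).1 (h0 F hF).2
    exact ⟨p, fun a ha => hp (ha F hF)⟩
  · rintro ⟨⟨f, ⟨h, g, hfrac⟩, rfl⟩, p, hp⟩
    let Q (q : TropPoly R n) (x : Monom R n × Monom R n) :=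
      (p.mul q).add ⟨{x.1.mul x.2}, Finset.singleton_nonempty _⟩
    -- The member `p` confines the locus to the corners of `p`; there the other members express `h ≤
    -- g` and `g ≤ h`.
    let T : Set (TropPoly R n) := {p} ∪ (Q g '' (p.monoms ×ˢ h.monoms : Finset _) ∪
      Q h '' (p.monoms ×ˢ g.monoms : Finset _))
    have hT : T.Finite := (finite_singleton p).union
      (((Finset.finite_toSet _).image _).union ((Finset.finite_toSet _).image _))
    have hZ : ∀ a, (∀ q ∈ T, a ∈ q.corner) ↔ f a = 1 := by
      intro a
      have e : (∀ q ∈ T, a ∈ q.corner) ↔ a ∈ p.corner ∧ h.eval a ≤ g.eval a ∧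
          g.eval a ≤ h.eval a := by
        simp only [T, mem_union, mem_singleton_iff, or_imp, forall_and, forall_eq,
          forall_mem_image]
        refine and_congr_right fun ha => and_congr ?_ ?_
        · rw [h.eval_le_iff]
          simp only [← p.forall_mem_corner_iff g _ ha, Finset.coe_product, mem_prod,
            Finset.mem_coe, Q]
          exact ⟨fun H m hm k hk => H (x := (k, m)) ⟨hk, hm⟩, fun H x hx => H x.2 hx.2 x.1 hx.1⟩
        · rw [g.eval_le_iff]
          simp only [← p.forall_mem_corner_iff h _ ha, Finset.coe_product, mem_prod,
            Finset.mem_coe, Q]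
          exact ⟨fun H m hm k hk => H (x := (k, m)) ⟨hk, hm⟩, fun H x hx => H x.2 hx.2 x.1 hx.1⟩
      rw [e, ← le_antisymm_iff, hfrac, div_eq_one]
      refine and_iff_right_of_imp fun ha => hp ?_
      rw [mem_ofPred_eq, hfrac, div_eq_one]
      exact ha
    refine ⟨TropPoly.toMv '' T, hT.image _, ⟨_, p, Or.inl rfl, rfl⟩, ?_, ?_⟩
    · rintro _ ⟨q, -, rfl⟩
      exact ⟨q.toMv_ne_zero, q.isTangiblePoly_toMv⟩
    · ext a
      rw [mem_ofPred_eq, ← hZ]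
      simp only [Cor, mem_ofPred_eq, forall_mem_image, TropPoly.isCornerRoot_toMv]

end CornerLoci

end TropKernel

/-! ### The correspondence between principal kernels and corner loci. -/

theorem mainTheorem8 (R : Type*) [CommGroup R] [LinearOrder R] [IsOrderedMonoid R]
    [Nontrivial R] [MulArchimedean R]
    (hdiv : ∀ k : ℕ, k ≠ 0 → ∀ a : R, ∃ b : R, b ^ k = a)
    (hcomplete : ∀ s : Set R, s.Nonempty → BddAbove s → ∃ c, IsLUB s c)
    (n : ℕ) :
    TropKernel.IsLatticeCorrespondence TropKernel.Skel
        (TropKernel.PCon (TropKernel.constKernel R n)) (TropKernel.FCL R n) ∧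
      TropKernel.IsLatticeCorrespondence TropKernel.Skel
        (TropKernel.RegPCon (TropKernel.constKernel R n)) (TropKernel.FRCL R n) ∧
      (∀ K ∈ TropKernel.PCon (TropKernel.constKernel R n),
        TropKernel.Ker (TropKernel.constKernel R n) (TropKernel.Skel K) = K) ∧
      (∀ Z ∈ TropKernel.FCL R n,
        TropKernel.Skel (TropKernel.Ker (TropKernel.constKernel R n) Z) = Z) := by
  open TropKernel in
  refine ⟨?_, ?_, ?_, ?_⟩
  · rw [pCon_constKernel hdiv, fcl_eq_fracLoci]
    exact isLatticeCorrespondence_of_subset_fracLoci hdiv subset_rfl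
      (fun _ hZ _ hZ' => fracLoci_inter hZ hZ') (fun _ hZ _ hZ' => fracLoci_union hZ hZ')
  · rw [regPCon_constKernel hdiv, frcl_eq_thinLoci]
    exact isLatticeCorrespondence_of_subset_fracLoci hdiv (fun _ hZ => hZ.1)
      (fun _ hZ _ hZ' => thinLoci_inter hZ hZ') (fun _ hZ _ hZ' => thinLoci_union hZ hZ')
  · rw [pCon_constKernel hdiv]
    rintro _ ⟨Z, hZ, rfl⟩
    rw [skel_ker_of_mem_fracLoci hZ]
  · rw [fcl_eq_fracLoci]
    exact fun Z hZ => skel_ker_of_mem_fracLoci hZ
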